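/- **Theorem 4 (Delay of Modular Architectures).** Consider a system with $n\ge 1$ queues and $n$ servers. The connections are given by a bipartite graph $g$: server $j$ may serve queue $i$ iff $(i,j)$ is an edge of $g$. Jobs arrive to queue $i$ according to independent Poisson processes of rates $\lambda_i\ge 0$; job sizes are independent of each other and of the arrivals, and exponentially distributed with mean $1$; every server works at rate $1$, on one job at a time, without interruption; each queue is first-in-first-out; the system is empty at time $0$. The capacity region $\mathbf R(g)$ is the set of vectors $\lambda\in\mathbb R^n$ for which there are flows $f_{ij}\ge 0$ on the edges of $g$ with $\lambda_i=\sum_{j:(i,j)\in g} f_{ij}$ for every queue $i$ and $\sum_{i:(i,j)\in g} f_{ij}<1$ for every server $j$; put $\gamma\mathbf R(g)=\{\gamma x : x\in\mathbf R(g)\}$. A *modular architecture* with cluster size $d$ is a graph $g_n$ obtained by partitioning the servers into the $n/d$ consecutive clusters $B_1,\dots,B_{n/d}$ of size $d$, partitioning the queues in any way into clusters $A_1,\dots,A_{n/d}$ of size $d$, and connecting a queue to a server iff their clusters have the same index. A *greedy policy* immediately assigns a job that arrives to a queue in $A_k$ to some idle server in $B_k$ if there is one (otherwise the job waits), and lets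 a server in $B_k$ that completes a service immediately fetch a job from some non-empty queue in $A_k$ if there is one (otherwise the server becomes idle); the choices are arbitrary measurable functions of the history of the system (arrivals and service completions) up to that time. Thus each cluster runs as an $M/M/d$ queue. Let $W_{i,m}$ be the waiting time (from arrival to initiation of service) of the $m$-th job of queue $i$, let $\mathbb E[W_i]=\limsup_{m\to\infty}\mathbb E[W_{i,m}]$, and let $$\mathbb E[W\mid\lambda,g,\pi]=\frac{\sum_i\lambda_i\,\mathbb E[W_i]}{\sum_i\lambda_i}\in[0,\infty]$$ be the expected average delay under the policy $\pi$ (understood as $0$ if $\lambda=0$; terms with $\lambda_i=0$ are $0$). Fix $\gamma\in(0,1)$. There are constants $c>0$ and $K>0$, depending only on $\gamma$, such that for every $n\ge 1$, every cluster size $d_n$, every modular architecture $g_n$ on $n$ queues and $n$ servers with cluster size $d_n$, every greedy policy $\pi$, and every $\lambda_n\in\gamma\,\mathbf R(g_n)$, $$\mathbb E[W\mid\lambda_n,g_n,\pi]\;\le\; K\exp(-c\,d_n).$$ In particular, $\mathbb E[W\mid\lambda_n]\lesssim\exp(-c\,d_n)$ as $n\to\infty$, with $c$ independent of $n$ and of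 the sequence $(g_n)$. -/

import Mathlib

open MeasureTheory ProbabilityTheory Filter
open scoped ENNReal Pointwise

noncomputable section

namespace Flex

/-- An `n × n` bipartite graph, given by its edge set: `(i, j) ∈ g` means that queue `i` (a left
node) is connected to server `j` (a right node), i.e. server `j` is capable of serving queue `i`. -/
abbrev Architecture (n : ℕ) : Type := Finset (Fin n × Fin n)

/-- The capacity region `R(g)`: the arrival rate vectors that are satisfied by some flow on the
edges of `g` that loads every server strictly less than its service rate `1`. -/
def capacityRegion {n : ℕ} (g : Architecture n) : Set (Fin n → ℝ) :=
  {rate | ∃ f : Fin n → Fin n → ℝ,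
    (∀ i, rate i = ∑ j with (i, j) ∈ g, f i j) ∧
    (∀ j, ∑ i with (i, j) ∈ g, f i j < 1) ∧
    (∀ i j, (i, j) ∈ g → 0 ≤ f i j)}

/-- Modular architectures with clusters of size `d`. The server clusters are
`B_0 = {0, …, d-1}`, `B_1 = {d, …, 2d-1}`, …, so that server `j` is in cluster `j / d`. The map `σ`
sends a queue to (the index of) its cluster, and each of the `n / d` queue clusters has exactly `d`
elements (for `n ≥ 1` this forces `0 < d` and `d ∣ n`). A queue and a server are connected exactly
when their clusters have the same index. -/
def IsModular {n : ℕ} (d : ℕ) (g : Architecture n) : Prop :=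
  ∃ σ : Fin n → Fin (n / d),
    (∀ k, (Finset.univ.filter fun i => σ i = k).card = d) ∧
    ∀ i j, (i, j) ∈ g ↔ (σ i : ℕ) = (j : ℕ) / d

/-- The events of the system: `Sum.inl i` is an arrival to queue `i`, and `Sum.inr j` is a service
completion at server `j`. -/
abbrev Event (n : ℕ) : Type := Fin n ⊕ Fin n

/-- The first `k` events (arrivals and service completions), together with their times. -/
abbrev History (n k : ℕ) : Type := Fin k → Event n × ℝ≥0∞

/-- A greedy scheduling policy never lets a server idle while one of its queues is non-empty. What
is left for it to decide is (a) to which of the idle servers an arriving job goes, if there is one,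
and (b) from which of the non-empty queues a server that completes a service fetches its next job,
if there is one. These decisions are causal: they depend on the history up to and including the
current event, and on the set of admissible choices (which is itself determined by the history). -/
structure GreedyPolicy (n : ℕ) where
  /-- the choice from a set of idle servers, when a job arrives -/
  server : (k : ℕ) → History n k → Finset (Fin n) → Fin n
  /-- the choice from a set of non-empty queues, when a service is completed -/
  queue : (k : ℕ) → History n k → Finset (Fin n) → Fin n
  server_mem : ∀ k h A, A.Nonempty → server k h A ∈ A
  queue_mem : ∀ k h A, A.Nonempty → queue k h A ∈ A
  measurable_server : ∀ k A, Measurable fun h => server k h A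
  measurable_queue : ∀ k A, Measurable fun h => queue k h A

instance instIsProbabilityMeasureExpOne : IsProbabilityMeasure (expMeasure 1) :=
  isProbabilityMeasure_expMeasure one_pos

/-- The sample space of the primitive random variables. The first component holds the interarrival
times before normalization by the arrival rates, the second one holds the job sizes; both are
indexed by queue and by job (the jobs of each queue being numbered `0, 1, 2, …` as they arrive). -/
abbrev Sample (n : ℕ) : Type := (Fin n × ℕ → ℝ) × (Fin n × ℕ → ℝ)

/-- All primitive random variables are independent and exponential with mean `1`. -/
def law (n : ℕ) : Measure (Sample n) :=
  (Measure.infinitePi fun _ : Fin n × ℕ => expMeasure 1).prod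
    (Measure.infinitePi fun _ : Fin n × ℕ => expMeasure 1)

/-- The time of arrival of job `m` of queue `i`. The interarrival times at queue `i` are independent
exponentials with mean `1` divided by the rate, so that arrivals to queue `i` form a Poisson process
of that rate; if the rate is `0`, the arrival times are infinite. -/
def arrivalTime {n : ℕ} (rate : Fin n → ℝ) (ω : Sample n) (i : Fin n) (m : ℕ) : ℝ≥0∞ :=
  (∑ l ∈ Finset.range (m + 1), ENNReal.ofReal (ω.1 (i, l))) / ENNReal.ofReal (rate i)

/-- The size of job `m` of queue `i`, which is its service time, as all servers run at rate `1`. -/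
def jobSize {n : ℕ} (ω : Sample n) (i : Fin n) (m : ℕ) : ℝ≥0∞ :=
  ENNReal.ofReal (ω.2 (i, m))

/-- The state of the system immediately after an event. -/
structure State (n : ℕ) where
  /-- the time of the last event -/
  time : ℝ≥0∞
  /-- the number of jobs that have arrived to each queue -/
  arrived : Fin n → ℕ
  /-- the number of jobs of each queue whose service has been initiated; the other jobs that have
  arrived are waiting in the queue -/
  fetched : Fin n → ℕ
  /-- the time at which each server will complete its current service, `⊤` if it is idle -/
  completion : Fin n → ℝ≥0∞

/-- The system is empty at time `0`. -/
def State.init (n : ℕ) : State n where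
  time := 0
  arrived := fun _ => 0
  fetched := fun _ => 0
  completion := fun _ => ⊤

/-- Server `j` fetches the first waiting job of queue `i` (queues are first-in-first-out), and works
on it, without interruption, for a time equal to its size. -/
def State.startService {n : ℕ} (ω : Sample n) (s : State n) (i j : Fin n) : State n :=
  { s with
    fetched := Function.update s.fetched i (s.fetched i + 1)
    completion := Function.update s.completion j (s.time + jobSize ω i (s.fetched i)) }

/-- The time at which each event is going to happen next. -/
def State.clock {n : ℕ} (rate : Fin n → ℝ) (ω : Sample n) (s : State n) : Event n → ℝ≥0∞ :=
  Sum.elim (fun i => arrivalTime rate ω i (s.arrived i)) s.completion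

/-- The event that happens next (ties, which have probability zero, are broken arbitrarily). -/
def State.nextEvent {n : ℕ} [NeZero n] (rate : Fin n → ℝ) (ω : Sample n) (s : State n) : Event n :=
  Classical.choose (Finite.exists_min (s.clock rate ω))

open Classical in
/-- The effect of the event `e`, happening at time `t`, where `h` is the history up to and including
this event. At an arrival to queue `i`, the job is immediately assigned to an idle server connected
to `i`, if there is one, and waits in the queue otherwise. At a service completion at server `j`,
the server immediately fetches a job from a non-empty queue connected to `j`, if there is one, and
becomes idle otherwise. -/
def State.step {n : ℕ} (g : Architecture n) (π : GreedyPolicy n) (ω : Sample n) (s : State n)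
    (e : Event n) (t : ℝ≥0∞) {k : ℕ} (h : History n k) : State n :=
  match e with
  | Sum.inl i =>
    let s' : State n := { s with
      time := t
      arrived := Function.update s.arrived i (s.arrived i + 1) }
    let A : Finset (Fin n) := Finset.univ.filter fun j => (i, j) ∈ g ∧ s'.completion j = ⊤
    if A.Nonempty then s'.startService ω i (π.server k h A) else s'
  | Sum.inr j =>
    let s' : State n := { s with
      time := t
      completion := Function.update s.completion j ⊤ }
    let A : Finset (Fin n) := Finset.univ.filter fun i => (i, j) ∈ g ∧ s'.fetched i < s'.arrived i
    if A.Nonempty then s'.startService ω (π.queue k h A) j else s'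

/-- The evolution of the system: its state immediately after the `k`-th event, and the history of
the first `k` events. -/
def run {n : ℕ} [NeZero n] (g : Architecture n) (π : GreedyPolicy n) (rate : Fin n → ℝ)
    (ω : Sample n) : (k : ℕ) → State n × History n k
  | 0 => (State.init n, Fin.elim0)
  | k + 1 =>
    let s : State n := (run g π rate ω k).1
    let e : Event n := s.nextEvent rate ω
    let t : ℝ≥0∞ := s.clock rate ω e
    let h : History n (k + 1) :=
      Fin.snoc (α := fun _ => Event n × ℝ≥0∞) (run g π rate ω k).2 (e, t)
    (s.step g π ω e t h, h)

open Classical in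
/-- The time at which the service of job `m` of queue `i` is initiated: the time of the first event
after which more than `m` jobs of queue `i` have been fetched (`⊤` if there is none). -/
def startTime {n : ℕ} [NeZero n] (g : Architecture n) (π : GreedyPolicy n) (rate : Fin n → ℝ)
    (ω : Sample n) (i : Fin n) (m : ℕ) : ℝ≥0∞ :=
  ⨅ k : ℕ, if m < (run g π rate ω k).1.fetched i then (run g π rate ω k).1.time else ⊤

/-- The waiting time in queue `W_{i,m}` of job `m` of queue `i`. -/
def waitingTime {n : ℕ} [NeZero n] (g : Architecture n) (π : GreedyPolicy n) (rate : Fin n → ℝ)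
    (ω : Sample n) (i : Fin n) (m : ℕ) : ℝ≥0∞ :=
  startTime g π rate ω i m - arrivalTime rate ω i m

/-- `E[W_i] = limsup_{m → ∞} E[W_{i,m}]`. -/
def queueDelay {n : ℕ} [NeZero n] (g : Architecture n) (π : GreedyPolicy n) (rate : Fin n → ℝ)
    (i : Fin n) : ℝ≥0∞ :=
  limsup (fun m : ℕ => ∫⁻ ω, waitingTime g π rate ω i m ∂(law n)) atTop

/-- The expected average delay `E[W | λ, g, π] = (∑ i, λ_i E[W_i]) / ∑ i, λ_i`, with values in
`[0, ∞]` (it is `0` for the zero arrival rate vector). -/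
def expectedDelay {n : ℕ} [NeZero n] (g : Architecture n) (π : GreedyPolicy n)
    (rate : Fin n → ℝ) : ℝ≥0∞ :=
  (∑ i, ENNReal.ofReal (rate i) * queueDelay g π rate i) / ∑ i, ENNReal.ofReal (rate i)

end Flex

end

/-! ### The exponential law -/

noncomputable section

namespace Flex

/-! The delay of a queue depends only on its cluster. Let `Λ ≤ γ d` be the total arrival rate of the
cluster and `x` its load, the number of jobs waiting or in service. Greediness keeps exactly `min x
d` servers busy (`Config.busyCount_eq_min`), so the load moves like an M/M/d queue whatever the
policy chooses (`Config.load_next`). Fix `1 < θ < γ⁻¹`.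

Two Lyapunov functions give the bound. When at least `(1 + γ θ) / 2 * d` servers are busy, `θ ^ x`
has negative drift (`exponential_drift`); hence the mean of `θ ^ x` found by an arriving job is at
most some `κ` of order `θ ^ ((1 + γ θ) / 2 * d)`. A job waits only while `x > d`, where `x - d` has
drift at most `-(1 - γ)`; so its mean wait is at most the mean of `(x + 1 - d)⁺` upon arrival,
divided by `1 - γ`. As `(x + 1 - d)⁺ ≤ C * θ ^ x` with `C` of order `θ ^ (-d)`, the wait is of order
`θ ^ (-(1 - γ θ) / 2 * d)`.

Neither Markov process theory nor stationarity is used. The drift arguments rest on the compensation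
formula `lintegral_event`: the mean of a function of the configuration and the next event is the
mean of its intensity-weighted sum over events times the gap to the next event. It is proved by
Tonelli: one running exponential clock is resampled while all other variables are frozen. By
`sim_setVar` the past does not notice this as long as the clock has not expired, and what remains is
the constant hazard rate of the exponential law.

Summing drift inequalities over events gives `sum_lintegral_pow_load_le`, where induction on the
number of the job replaces stationarity, and then `sum_lintegral_waiting_le`. Almost surely there
are no relevant ties, and every job eventually arrives and is fetched, so these sums do control the
waiting times. -/

lemma expMeasure_one_Ioi {u : ℝ} (hu : 0 ≤ u) :
    expMeasure 1 (Set.Ioi u) = ENNReal.ofReal (Real.exp (-u)) := by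
  have h := cdf_expMeasure_eq one_pos u
  rw [if_pos hu, one_mul, cdf_eq_real] at h
  rw [← Set.compl_Iic, prob_compl_eq_one_sub measurableSet_Iic, ← ofReal_measureReal, h,
    ← ENNReal.ofReal_one, ← ENNReal.ofReal_sub _ (by simpa using hu)]
  simp

lemma expMeasure_one_Iic_zero : expMeasure 1 (Set.Iic 0) = 0 := by
  have h := cdf_expMeasure_eq one_pos 0
  rw [cdf_eq_real] at h
  rw [← ofReal_measureReal, h]
  simp

lemma ae_pos_expMeasure_one : ∀ᵐ x ∂(expMeasure 1), 0 < x := by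
  rw [ae_iff]
  simp_rw [not_lt]
  exact expMeasure_one_Iic_zero

instance instNullSingletonClassExpOne : NullSingletonClass (expMeasure 1) :=
  inferInstanceAs (NullSingletonClass (volume.withDensity (gammaPDF 1 1)))

/-- The exponential distribution has constant hazard rate. -/
lemma lintegral_volume_inter_Iio_expMeasure_one {I : Set ℝ} (hI : MeasurableSet I)
    (h0 : I ⊆ Set.Ici 0) :
    ∫⁻ x, volume (I ∩ Set.Iio x) ∂(expMeasure 1) = expMeasure 1 I := by
  have h1 : ∀ x, volume (I ∩ Set.Iio x) =
      ∫⁻ u, I.indicator 1 u * (Set.Iio x).indicator 1 u := by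
    intro x
    rw [← lintegral_indicator_one (hI.inter measurableSet_Iio)]
    congr 1 with u
    by_cases h : u ∈ I <;> by_cases h' : u < x <;> simp [h, h']
  -- After Tonelli, the inner integral is the tail at `u`, and for the unit exponential law the tail
  -- equals the density: the hazard rate is `1`.
  have h2 : ∀ u : ℝ, ∫⁻ x, I.indicator 1 u * (Set.Iio x).indicator 1 u ∂(expMeasure 1) =
      I.indicator (exponentialPDF 1) u := by
    intro u
    by_cases hu : u ∈ I
    · have : ∀ x : ℝ, (Set.Iio x).indicator (1 : ℝ → ℝ≥0∞) u = (Set.Ioi u).indicator 1 x := by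
        intro x; simp [Set.indicator_apply]
      simp only [hu, Set.indicator_of_mem, Pi.one_apply, one_mul, this]
      rw [lintegral_indicator_one measurableSet_Ioi, expMeasure_one_Ioi (h0 hu),
        exponentialPDF_of_nonneg (h0 hu)]
      simp
    · simp [hu]
  simp_rw [h1]
  rw [lintegral_lintegral_swap]
  · simp_rw [h2]
    rw [lintegral_indicator hI, expMeasure, gammaMeasure, withDensity_apply _ hI]
    rfl
  · apply Measurable.aemeasurable
    apply Measurable.mul
    · exact (measurable_one.indicator hI).comp measurable_snd
    · have : (Function.uncurry fun x u : ℝ => (Set.Iio x).indicator (1 : ℝ → ℝ≥0∞) u) =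
          {p : ℝ × ℝ | p.2 < p.1}.indicator 1 := by
        ext p; simp [Set.indicator_apply, Function.uncurry]
      change Measurable (Function.uncurry fun x u : ℝ => (Set.Iio x).indicator (1 : ℝ → ℝ≥0∞) u)
      rw [this]
      exact measurable_one.indicator (measurableSet_lt measurable_snd measurable_fst)

/-! ### Resampling one primitive random variable -/

lemma measurePreserving_update_infinitePi {ι X : Type*} [DecidableEq ι] [MeasurableSpace X]
    (μ : Measure X) [IsProbabilityMeasure μ] (i : ι) :
    MeasurePreserving (fun p : (ι → X) × X => Function.update p.1 i p.2)
      ((Measure.infinitePi fun _ : ι => μ).prod μ) (Measure.infinitePi fun _ : ι => μ) := by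
  have hm : Measurable fun p : (ι → X) × X => Function.update p.1 i p.2 := by
    rw [measurable_pi_iff]
    intro j
    by_cases h : j = i
    · subst h; simpa using measurable_snd
    · simp only [Function.update_of_ne h]; fun_prop
  refine ⟨hm, Measure.eq_infinitePi _ fun s t ht => ?_⟩
  rw [Measure.map_apply hm (.pi s.countable_toSet fun _ _ => ht _)]
  by_cases hi : i ∈ s
  · have : (fun p : (ι → X) × X => Function.update p.1 i p.2) ⁻¹' ((s : Set ι).pi t) =
        (((s.erase i : Finset ι) : Set ι).pi t) ×ˢ t i := by
      ext ⟨f, x⟩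
      simp only [Set.mem_preimage, Set.mem_pi, Finset.mem_coe, Set.mem_prod, Finset.mem_erase]
      constructor
      · intro h
        refine ⟨fun j hj => ?_, by simpa using h i hi⟩
        simpa [Function.update_of_ne hj.1] using h j hj.2
      · rintro ⟨h, hx⟩ j hj
        by_cases hji : j = i
        · subst hji; simpa using hx
        · simpa [Function.update_of_ne hji] using h j ⟨hji, hj⟩
    rw [this, Measure.prod_prod, Measure.infinitePi_pi _ (fun _ _ => ht _),
      Finset.prod_erase_mul _ _ hi]
  · have : (fun p : (ι → X) × X => Function.update p.1 i p.2) ⁻¹' ((s : Set ι).pi t) =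
        ((s : Set ι).pi t) ×ˢ Set.univ := by
      ext ⟨f, x⟩
      simp only [Set.mem_preimage, Set.mem_pi, Finset.mem_coe, Set.mem_prod, Set.mem_univ, and_true]
      refine forall₂_congr fun j hj => ?_
      rw [Function.update_of_ne (by rintro rfl; exact hi hj)]
    rw [this, Measure.prod_prod, Measure.infinitePi_pi _ (fun _ _ => ht _)]
    simp

/-- The primitive random variables: `Sum.inl (i, m)` is the normalized interarrival time before job
`m` of queue `i`, and `Sum.inr (i, m)` is the size of that job. -/
abbrev Var (n : ℕ) : Type := (Fin n × ℕ) ⊕ (Fin n × ℕ)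

/-- Replace the value of a primitive random variable. -/
def setVar {n : ℕ} (v : Var n) (x : ℝ) (ω : Sample n) : Sample n :=
  match v with
  | Sum.inl p => (Function.update ω.1 p x, ω.2)
  | Sum.inr p => (ω.1, Function.update ω.2 p x)

@[simp] lemma setVar_setVar {n : ℕ} (v : Var n) (x y : ℝ) (ω : Sample n) :
    setVar v x (setVar v y ω) = setVar v x ω := by
  cases v <;> simp [setVar]

instance {n : ℕ} : IsProbabilityMeasure (law n) := by unfold law; infer_instance

lemma measurePreserving_setVar {n : ℕ} (v : Var n) :
    MeasurePreserving (fun p : Sample n × ℝ => setVar v p.2 p.1)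
      ((law n).prod (expMeasure 1)) (law n) := by
  cases v with
  | inl v =>
    have h1 := measurePreserving_update_infinitePi (expMeasure 1) v
    have h2 := h1.prod (MeasurePreserving.id (Measure.infinitePi fun _ : Fin n × ℕ => expMeasure 1))
    have hs : MeasurePreserving (fun p : Sample n × ℝ => ((p.1.1, p.2), p.1.2))
        ((law n).prod (expMeasure 1))
        (((Measure.infinitePi fun _ : Fin n × ℕ => expMeasure 1).prod (expMeasure 1)).prod
          (Measure.infinitePi fun _ : Fin n × ℕ => expMeasure 1)) := by
      have a1 := measurePreserving_prodAssoc (Measure.infinitePi fun _ : Fin n × ℕ => expMeasure 1)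
        (Measure.infinitePi fun _ : Fin n × ℕ => expMeasure 1) (expMeasure 1)
      have a2 := (MeasurePreserving.id (Measure.infinitePi fun _ : Fin n × ℕ => expMeasure 1)).prod
        (Measure.measurePreserving_swap (μ := Measure.infinitePi fun _ : Fin n × ℕ => expMeasure 1)
          (ν := expMeasure 1))
      have a3 := (measurePreserving_prodAssoc
        (Measure.infinitePi fun _ : Fin n × ℕ => expMeasure 1) (expMeasure 1)
        (Measure.infinitePi fun _ : Fin n × ℕ => expMeasure 1)).symm
      exact (a3.comp a2).comp a1
    exact h2.comp hs
  | inr v =>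
    have h1 := measurePreserving_update_infinitePi (expMeasure 1) v
    have h2 := (MeasurePreserving.id (Measure.infinitePi fun _ : Fin n × ℕ => expMeasure 1)).prod h1
    exact h2.comp (measurePreserving_prodAssoc _ _ _)

/-- Independence enters the proof only in this form: any single variable can be integrated out
first, with all the others frozen. This takes the place of conditioning on the past. -/
lemma lintegral_eq_lintegral_setVar {n : ℕ} (v : Var n) {f : Sample n → ℝ≥0∞}
    (hf : Measurable f) :
    ∫⁻ ω, f ω ∂(law n) = ∫⁻ ω, ∫⁻ x, f (setVar v x ω) ∂(expMeasure 1) ∂(law n) := by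
  rw [← (measurePreserving_setVar v).lintegral_comp hf,
    lintegral_prod (fun p : Sample n × ℝ => f (setVar v p.2 p.1))
      (hf.comp (measurePreserving_setVar v).measurable).aemeasurable]

end Flex

end

noncomputable section

namespace Flex

variable {n : ℕ}

/-! ### Configurations -/

/-- The discrete part of the state of the system: `job j` is the job in service at server `j`. -/
@[ext] structure Config (n : ℕ) where
  /-- the number of jobs that have arrived to each queue -/
  arrived : Fin n → ℕ
  /-- the number of jobs of each queue whose service has been initiated -/
  fetched : Fin n → ℕ
  /-- the job in service at each server, if any -/
  job : Fin n → Option (Fin n × ℕ)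

instance : MeasurableSpace (Config n) := ⊤

instance : Countable (Config n) :=
  Function.Injective.countable (f := fun c : Config n => (c.arrived, c.fetched, c.job))
    fun c c' h => by
      simp only [Prod.mk.injEq] at h
      exact Config.ext h.1 h.2.1 h.2.2

namespace Config

/-- The empty system. -/
def init (n : ℕ) : Config n := ⟨fun _ => 0, fun _ => 0, fun _ => none⟩

open Classical in
/-- The idle servers that can take an arriving job, and the non-empty queues from which a server
that completes a service can fetch a job. -/
def admissible (g : Architecture n) (c : Config n) : Event n → Finset (Fin n)
  | Sum.inl i => Finset.univ.filter fun j => (i, j) ∈ g ∧ c.job j = none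
  | Sum.inr j => Finset.univ.filter fun i => (i, j) ∈ g ∧ c.fetched i < c.arrived i

/-- The effect of an event before any service is initiated. -/
def record (c : Config n) : Event n → Config n
  | Sum.inl i => { c with arrived := Function.update c.arrived i (c.arrived i + 1) }
  | Sum.inr j => { c with job := Function.update c.job j none }

/-- Server `j` fetches a job from queue `i`. -/
def serve (c : Config n) (i j : Fin n) : Config n :=
  { c with
    fetched := Function.update c.fetched i (c.fetched i + 1)
    job := Function.update c.job j (some (i, c.fetched i)) }

/-- The queue involved in the service initiated at the event `e` if the choice `p` is made. -/
def servedQueue (e : Event n) (p : Fin n) : Fin n := e.elim id fun _ => p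

/-- The server involved in the service initiated at the event `e` if the choice `p` is made. -/
def servingServer (e : Event n) (p : Fin n) : Fin n := e.elim (fun _ => p) id

open Classical in
/-- The configuration after the event `e` if the choice `p` is made. -/
def next (g : Architecture n) (c : Config n) (e : Event n) (p : Fin n) : Config n :=
  if (c.admissible g e).Nonempty then
    (c.record e).serve (servedQueue e p) (servingServer e p)
  else c.record e

/-- The primitive random variable that determines the time of the next event of each type. -/
def active (c : Config n) : Event n → Option (Var n)
  | Sum.inl i => some (Sum.inl (i, c.arrived i))
  | Sum.inr j => (c.job j).map Sum.inr

/-- The primitive random variables that have played no role yet. -/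
def Fresh (c : Config n) : Var n → Prop
  -- The interarrival time numbered `arrived` is already running, hence the strict inequality. The
  -- size of a job that has arrived but has not been fetched is still fresh.
  | Sum.inl p => c.arrived p.1 < p.2
  | Sum.inr p => c.fetched p.1 ≤ p.2

/-- The properties of the configurations that are reached under a greedy policy. -/
structure Valid (g : Architecture n) (c : Config n) : Prop where
  fetched_le : ∀ i, c.fetched i ≤ c.arrived i
  lt_fetched : ∀ j q, c.job j = some q → q.2 < c.fetched q.1
  job_inj : ∀ j j' q, c.job j = some q → c.job j' = some q → j = j'
  busy : ∀ i j, (i, j) ∈ g → c.fetched i < c.arrived i → c.job j ≠ none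

lemma valid_init (g : Architecture n) : (init n).Valid g := by
  constructor <;> simp [init]

/-- An arriving job finds an admissible idle server only if its queue is empty, so that it is itself
the job being fetched. Conversely, if no server is admissible, all servers connected to the queue
are busy, which preserves `busy`. Newly fetched jobs carry a number not yet in use, which preserves
`job_inj`. -/
lemma Valid.next {g : Architecture n} {c : Config n} (hc : c.Valid g) {e : Event n} {p : Fin n}
    (hp : (c.admissible g e).Nonempty → p ∈ c.admissible g e) : (c.next g e p).Valid g := by
  classical
  unfold Config.next
  rcases e with i | j
  · split_ifs with hA
    · have hp := hp hA
      simp only [admissible, Finset.mem_filter, Finset.mem_univ, true_and] at hp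
      have hfa : c.fetched i = c.arrived i :=
        le_antisymm (hc.fetched_le i) (not_lt.1 fun h => hc.busy i p hp.1 h hp.2)
      simp only [record, serve, servedQueue, servingServer, Sum.elim_inl, id]
      constructor
      · intro i'
        have := hc.fetched_le i'
        by_cases h : i' = i
        · subst h; simp [this]
        · simp [h, this]
      · intro j' q hq
        by_cases h : j' = p
        · subst h
          simp only [Function.update_self, Option.some.injEq] at hq
          subst hq; simp
        · simp only [Function.update_of_ne h] at hq
          have := hc.lt_fetched j' q hq
          by_cases h' : q.1 = i
          · subst h'; simp; omega
          · simp [h', this]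
      · intro j1 j2 q h1 h2
        by_cases e1 : j1 = p <;> by_cases e2 : j2 = p
        · rw [e1, e2]
        · subst e1
          simp only [Function.update_self, Option.some.injEq, Function.update_of_ne e2] at h1 h2
          have := hc.lt_fetched _ _ h2
          subst h1; simp at this
        · subst e2
          simp only [Function.update_self, Option.some.injEq, Function.update_of_ne e1] at h1 h2
          have := hc.lt_fetched _ _ h1
          subst h2; simp at this
        · simp only [Function.update_of_ne e1, Function.update_of_ne e2] at h1 h2
          exact hc.job_inj _ _ _ h1 h2
      · intro i' j' hg hlt
        by_cases h : j' = p
        · subst h; simp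
        · simp only [Function.update_of_ne h]
          by_cases h' : i' = i
          · subst h'; simp [hfa] at hlt
          · exact hc.busy i' j' hg (by simpa [h'] using hlt)
    · simp only [record]
      constructor
      · intro i'
        have := hc.fetched_le i'
        by_cases h : i' = i
        · subst h; simp; omega
        · simp [h, this]
      · exact hc.lt_fetched
      · exact hc.job_inj
      · intro i' j' hg hlt
        by_cases h : i' = i
        · subst h
          intro hn
          exact hA ⟨j', by simpa [admissible, hg] using hn⟩
        · exact hc.busy i' j' hg (by simpa [h] using hlt)
  · split_ifs with hA
    · have hp := hp hA
      simp only [admissible, Finset.mem_filter, Finset.mem_univ, true_and] at hp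
      simp only [record, serve, servedQueue, servingServer, Sum.elim_inr, id,
        Function.update_idem]
      constructor
      · intro i'
        have := hc.fetched_le i'
        by_cases h : i' = p
        · subst h; simp; omega
        · simp [h, this]
      · intro j' q hq
        by_cases h : j' = j
        · subst h
          simp only [Function.update_self, Option.some.injEq] at hq
          subst hq; simp
        · simp only [Function.update_of_ne h] at hq
          have := hc.lt_fetched j' q hq
          by_cases h' : q.1 = p
          · subst h'; simp; omega
          · simp [h', this]
      · intro j1 j2 q h1 h2
        by_cases e1 : j1 = j <;> by_cases e2 : j2 = j
        · rw [e1, e2]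
        · subst e1
          simp only [Function.update_self, Option.some.injEq, Function.update_of_ne e2] at h1 h2
          have := hc.lt_fetched _ _ h2
          subst h1; simp at this
        · subst e2
          simp only [Function.update_self, Option.some.injEq, Function.update_of_ne e1] at h1 h2
          have := hc.lt_fetched _ _ h1
          subst h2; simp at this
        · simp only [Function.update_of_ne e1, Function.update_of_ne e2] at h1 h2
          exact hc.job_inj _ _ _ h1 h2
      · intro i' j' hg hlt
        by_cases h : j' = j
        · subst h; simp
        · simp only [Function.update_of_ne h]
          refine hc.busy i' j' hg ?_
          by_cases h' : i' = p
          · subst h'; exact hp.2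
          · simpa [h'] using hlt
    · simp only [record]
      constructor
      · exact hc.fetched_le
      · intro j' q hq
        by_cases h : j' = j
        · subst h; simp at hq
        · exact hc.lt_fetched j' q (by simpa [h] using hq)
      · intro j1 j2 q h1 h2
        by_cases e1 : j1 = j
        · subst e1; simp at h1
        by_cases e2 : j2 = j
        · subst e2; simp at h2
        simp only [Function.update_of_ne e1, Function.update_of_ne e2] at h1 h2
        exact hc.job_inj _ _ _ h1 h2
      · intro i' j' hg hlt
        by_cases h : j' = j
        · subst h
          exact absurd ⟨i', by simp [admissible, hg, hlt]⟩ hA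
        · simpa [Function.update_of_ne h] using hc.busy i' j' hg hlt

lemma arrived_next (g : Architecture n) (c : Config n) (e : Event n) (p i : Fin n) :
    (c.next g e p).arrived i = c.arrived i + if e = Sum.inl i then 1 else 0 := by
  classical
  unfold Config.next
  rcases e with i' | j
  · by_cases h : i' = i
    · subst h; rw [if_pos rfl]; split_ifs <;> simp [record, serve]
    · have h' : i ≠ i' := Ne.symm h
      have h'' : ¬(Sum.inl i' : Event n) = Sum.inl i := fun H => h (Sum.inl.inj H)
      rw [if_neg h'']
      split_ifs <;> simp [record, serve, h']
  · split_ifs <;> simp_all [record, serve]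

lemma fetched_le_next (g : Architecture n) (c : Config n) (e : Event n) (p i : Fin n) :
    c.fetched i ≤ (c.next g e p).fetched i := by
  classical
  have : (c.record e).fetched = c.fetched := by cases e <;> rfl
  unfold Config.next
  split_ifs
  · simp only [serve, this]
    by_cases h : i = servedQueue e p
    · subst h; simp
    · simp [h]
  · rw [this]

/-- A server other than the one at which a service is initiated keeps its job, unless it completes
it. -/
lemma job_next (g : Architecture n) (c : Config n) (e : Event n) (p j : Fin n)
    (hj : ¬((c.admissible g e).Nonempty ∧ j = servingServer e p)) :
    (c.next g e p).job j = if e = Sum.inr j then none else c.job j := by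
  classical
  have hr : (c.record e).job j = if e = Sum.inr j then none else c.job j := by
    rcases e with i | j'
    · simp [record]
    · by_cases h : j' = j
      · subst h; simp [record]
      · have h' : j ≠ j' := Ne.symm h
        simp [record, h, h']
  rw [← hr]
  unfold Config.next
  by_cases hA : (c.admissible g e).Nonempty
  · have : j ≠ servingServer e p := fun h => hj ⟨hA, h⟩
    simp only [if_pos hA, serve, Function.update_of_ne this]
  · simp only [if_neg hA]

lemma job_next_servingServer {g : Architecture n} {c : Config n} {e : Event n} (p : Fin n)
    (hA : (c.admissible g e).Nonempty) :
    (c.next g e p).job (servingServer e p) =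
      some (servedQueue e p, c.fetched (servedQueue e p)) := by
  classical
  have : (c.record e).fetched = c.fetched := by cases e <;> rfl
  unfold Config.next
  simp [hA, serve, this]

/-- A random variable that is fresh or active after an event was fresh or active before it. -/
lemma fresh_or_active_of_next {g : Architecture n} {c : Config n} {e : Event n} {p : Fin n}
    {v : Var n} (h : (c.next g e p).Fresh v ∨ ∃ e', (c.next g e p).active e' = some v)
    (hv : ¬c.Fresh v) :
    ∃ e', e' ≠ e ∧ c.active e' = some v ∧ (c.next g e p).active e' = some v ∧
      ¬((c.admissible g e).Nonempty ∧ e' = Sum.inr (servingServer e p)) := by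
  rcases v with ⟨i, m⟩ | ⟨i, m⟩
  · simp only [Fresh, not_lt, arrived_next] at hv h
    have key : m = c.arrived i ∧ e ≠ Sum.inl i := by
      rcases h with h | ⟨e', h⟩
      · omega
      · rcases e' with i' | j'
        · simp only [active, arrived_next, Option.some.injEq, Sum.inl.injEq, Prod.mk.injEq] at h
          obtain ⟨rfl, h⟩ := h
          by_cases he : e = Sum.inl i'
          · simp [he] at h; omega
          · simp [he] at h; exact ⟨h.symm, he⟩
        · simp [active] at h
    refine ⟨Sum.inl i, key.2.symm, by simp [active, key.1], ?_, by simp⟩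
    simp [active, arrived_next, key.1, key.2]
  · simp only [Fresh, not_le] at hv h
    have hf := fetched_le_next g c e p i
    have h : ∃ e', (c.next g e p).active e' = some (Sum.inr (i, m)) := by
      rcases h with h | h
      · omega
      · exact h
    obtain ⟨e', h⟩ := h
    rcases e' with i' | j
    · simp [active] at h
    · simp only [active, Option.map_eq_some_iff, Sum.inr.injEq, exists_eq_right] at h
      by_cases hj : (c.admissible g e).Nonempty ∧ j = servingServer e p
      · rw [hj.2, job_next_servingServer p hj.1] at h
        simp only [Option.some.injEq, Prod.mk.injEq] at h
        obtain ⟨rfl, rfl⟩ := h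
        exact absurd hv (lt_irrefl _)
      · have h2 := h
        rw [job_next _ _ _ _ _ hj] at h
        by_cases he : e = Sum.inr j
        · simp [he] at h
        · simp only [he, if_false] at h
          refine ⟨Sum.inr j, Ne.symm he, by simp [active, h], by simp [active, h2], ?_⟩
          rintro ⟨h1, h2⟩
          exact hj ⟨h1, Sum.inr.inj h2⟩

end Config

/-! ### The simulation -/

/-- The state of the system without the completion times, which are not part of the history. -/
structure Sim (n k : ℕ) where
  /-- the discrete part of the state -/
  config : Config n
  /-- the time of the last event -/
  time : ℝ≥0∞
  /-- the time at which the last service at each server was initiated -/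
  start : Fin n → ℝ≥0∞
  /-- the first `k` events, together with their times -/
  hist : History n k

/-- The choice made by a policy at an event. -/
def GreedyPolicy.choice (π : GreedyPolicy n) {k : ℕ} (h : History n k) (A : Finset (Fin n))
    (e : Event n) : Fin n := e.elim (fun _ => π.server k h A) fun _ => π.queue k h A

lemma GreedyPolicy.choice_mem (π : GreedyPolicy n) {k : ℕ} (h : History n k) (A : Finset (Fin n))
    (e : Event n) (hA : A.Nonempty) : π.choice h A e ∈ A := by
  cases e
  · exact π.server_mem k h A hA
  · exact π.queue_mem k h A hA

namespace Sim

variable {k : ℕ}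

/-- The rate of the exponential clock of each event. -/
def eventRate (rate : Fin n → ℝ) (e : Event n) : ℝ := e.elim rate fun _ => 1

/-- The time at which the clock of each event was started. -/
def origin (rate : Fin n → ℝ) (ω : Sample n) (S : Sim n k) (e : Event n) : ℝ≥0∞ :=
  e.elim (fun i => (∑ l ∈ Finset.range (S.config.arrived i), ENNReal.ofReal (ω.1 (i, l))) /
    ENNReal.ofReal (rate i)) S.start

/-- The time at which each server will complete its current service. -/
def completion (ω : Sample n) (S : Sim n k) (j : Fin n) : ℝ≥0∞ :=
  (S.config.job j).elim ⊤ fun q => S.start j + jobSize ω q.1 q.2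

/-- The time at which each event is going to happen next. -/
def clock (rate : Fin n → ℝ) (ω : Sample n) (S : Sim n k) : Event n → ℝ≥0∞ :=
  Sum.elim (fun i => arrivalTime rate ω i (S.config.arrived i)) (S.completion ω)

lemma clock_eq_top_of_active_eq_none {rate : Fin n → ℝ} {ω : Sample n} {S : Sim n k} {e : Event n}
    (h : S.config.active e = none) : S.clock rate ω e = ⊤ := by
  rcases e with i | j
  · simp [Config.active] at h
  · simp only [Config.active, Option.map_eq_none_iff] at h
    simp [clock, completion, h]

/-- The clock of an event is affine in its active variable, and its origin involves only earlier
interarrival times or a recorded start time. -/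
lemma clock_setVar_self {rate : Fin n → ℝ} {ω : Sample n} {S : Sim n k} {e : Event n} {v : Var n}
    (h : S.config.active e = some v) (x : ℝ) :
    S.clock rate (setVar v x ω) e =
      S.origin rate ω e + ENNReal.ofReal x / ENNReal.ofReal (eventRate rate e) := by
  rcases e with i | j
  · simp only [Config.active, Option.some.injEq] at h
    subst h
    simp only [clock, Sum.elim_inl, arrivalTime, origin, eventRate, setVar]
    rw [Finset.sum_range_succ, ENNReal.add_div]
    congr 2
    · refine Finset.sum_congr rfl fun l hl => ?_
      rw [Function.update_of_ne]
      have := Finset.mem_range.1 hl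
      simp; omega
    · simp
  · simp only [Config.active, Option.map_eq_some_iff] at h
    obtain ⟨q, hq, rfl⟩ := h
    simp [clock, completion, hq, origin, eventRate, setVar, jobSize]

lemma clock_setVar_of_ne {rate : Fin n → ℝ} {ω : Sample n} {S : Sim n k} {e : Event n} {v : Var n}
    (h1 : ∀ i m, v = Sum.inl (i, m) → e = Sum.inl i → S.config.arrived i < m)
    (h2 : ∀ q j, v = Sum.inr q → e = Sum.inr j → S.config.job j ≠ some q) (x : ℝ) :
    S.clock rate (setVar v x ω) e = S.clock rate ω e := by
  rcases e with i | j
  · rcases v with ⟨i', m⟩ | q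
    · simp only [clock, Sum.elim_inl, arrivalTime, setVar]
      congr 1
      refine Finset.sum_congr rfl fun l hl => ?_
      rw [Function.update_of_ne]
      have := Finset.mem_range.1 hl
      rintro ⟨⟩
      have := h1 _ _ rfl rfl
      omega
    · rfl
  · rcases v with q | q
    · rfl
    · simp only [clock, Sum.elim_inr, completion]
      rcases hj : S.config.job j with _ | q'
      · rfl
      · have : q' ≠ q := fun h => h2 q j rfl rfl (by rw [hj, h])
        simp [setVar, jobSize, this]

lemma clock_setVar_of_fresh {rate : Fin n → ℝ} {ω : Sample n} {S : Sim n k} {v : Var n}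
    {g : Architecture n} (hc : S.config.Valid g) (hv : S.config.Fresh v) (x : ℝ) :
    S.clock rate (setVar v x ω) = S.clock rate ω := by
  funext e
  refine clock_setVar_of_ne ?_ ?_ x
  · rintro i m rfl rfl; exact hv
  · rintro q j rfl rfl h
    have := hc.lt_fetched _ _ h
    simp only [Config.Fresh] at hv
    omega

lemma clock_setVar_of_active {rate : Fin n → ℝ} {ω : Sample n} {S : Sim n k} {v : Var n}
    {g : Architecture n} (hc : S.config.Valid g) {e e' : Event n}
    (hv : S.config.active e = some v) (he : e' ≠ e) (x : ℝ) :
    S.clock rate (setVar v x ω) e' = S.clock rate ω e' := by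
  refine clock_setVar_of_ne ?_ ?_ x
  · rintro i m rfl rfl
    rcases e with i' | j
    · simp only [Config.active, Option.some.injEq, Sum.inl.injEq, Prod.mk.injEq] at hv
      exact absurd (by rw [hv.1]) he
    · simp [Config.active] at hv
  · rintro q j rfl rfl h
    rcases e with i' | j'
    · simp [Config.active] at hv
    · simp only [Config.active, Option.map_eq_some_iff, Sum.inr.injEq, exists_eq_right] at hv
      exact he (congrArg _ (hc.job_inj _ _ _ h hv))

end Sim

/-! ### Deterministic tie-breaking and the step of the simulation -/

/-- The position of an event in the order by which ties are broken. -/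
def tieRank : Event n → ℕ := Sum.elim (fun i : Fin n => (i : ℕ)) fun j : Fin n => n + (j : ℕ)

lemma tieRank_injective : Function.Injective (tieRank (n := n)) := by
  rintro (i | j) (i' | j') h <;> simp only [tieRank, Sum.elim_inl, Sum.elim_inr] at h
  · rw [Fin.ext h]
  · have := i.2; omega
  · have := i'.2; omega
  · rw [Fin.ext (by omega : (j : ℕ) = j')]

/-- `e` is the first minimizer of `f`. -/
def IsFirst (f : Event n → ℝ≥0∞) (e : Event n) : Prop :=
  ∀ e', f e < f e' ∨ f e = f e' ∧ tieRank e ≤ tieRank e'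

lemma exists_isFirst [NeZero n] (f : Event n → ℝ≥0∞) : ∃ e, IsFirst f e := by
  obtain ⟨e, he⟩ := Finite.exists_min fun e => toLex (f e, tieRank e)
  exact ⟨e, fun e' => by simpa [Prod.Lex.le_iff] using he e'⟩

lemma IsFirst.unique {f : Event n → ℝ≥0∞} {e e' : Event n} (h : IsFirst f e) (h' : IsFirst f e') :
    e = e' := by
  apply tieRank_injective
  rcases h e' with h1 | h1 <;> rcases h' e with h2 | h2
  · exact absurd h1 h2.asymm
  · exact absurd h2.1.symm h1.ne
  · exact absurd h1.1.symm h2.ne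
  · exact le_antisymm h1.2 h2.2

lemma IsFirst.le {f : Event n → ℝ≥0∞} {e : Event n} (h : IsFirst f e) (e' : Event n) :
    f e ≤ f e' := by
  rcases h e' with h | h
  · exact h.le
  · exact h.1.le

/-- The first minimizer. -/
def firstEvent [NeZero n] (f : Event n → ℝ≥0∞) : Event n := (exists_isFirst f).choose

lemma isFirst_firstEvent [NeZero n] (f : Event n → ℝ≥0∞) : IsFirst f (firstEvent f) :=
  (exists_isFirst f).choose_spec

lemma IsFirst.eq [NeZero n] {f : Event n → ℝ≥0∞} {e : Event n} (h : IsFirst f e) :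
    firstEvent f = e := (isFirst_firstEvent f).unique h

namespace Sim

variable {k : ℕ}

/-- The history after one more event. -/
def nextHist (S : Sim n k) (e : Event n) (t : ℝ≥0∞) : History n (k + 1) :=
  Fin.snoc (α := fun _ => Event n × ℝ≥0∞) S.hist (e, t)

/-- The choice made by the policy at the event `e`, happening at time `t`. -/
def choice (g : Architecture n) (π : GreedyPolicy n) (S : Sim n k) (e : Event n) (t : ℝ≥0∞) :
    Fin n := π.choice (S.nextHist e t) (S.config.admissible g e) e

open Classical in
/-- The effect of the event `e`, happening at time `t`. -/
def step (g : Architecture n) (π : GreedyPolicy n) (S : Sim n k) (e : Event n) (t : ℝ≥0∞) :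
    Sim n (k + 1) where
  config := S.config.next g e (S.choice g π e t)
  time := t
  start := if (S.config.admissible g e).Nonempty then
    Function.update S.start (Config.servingServer e (S.choice g π e t)) t else S.start
  hist := S.nextHist e t

lemma choice_mem {g : Architecture n} {π : GreedyPolicy n} {S : Sim n k} {e : Event n} {t : ℝ≥0∞}
    (h : (S.config.admissible g e).Nonempty) : S.choice g π e t ∈ S.config.admissible g e :=
  π.choice_mem _ _ _ h

/-- The system is empty at time `0`. -/
def init (n : ℕ) : Sim n 0 := ⟨Config.init n, 0, fun _ => 0, Fin.elim0⟩

/-- The next event, ties being broken by `tieRank`. -/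
def nextEvent [NeZero n] (rate : Fin n → ℝ) (ω : Sample n) (S : Sim n k) : Event n :=
  firstEvent (S.clock rate ω)

/-- The properties of the states that are reached under a greedy policy. -/
structure Inv (g : Architecture n) (rate : Fin n → ℝ) (ω : Sample n) (S : Sim n k) : Prop where
  valid : S.config.Valid g
  time_ne_top : S.time ≠ ⊤
  origin_le : ∀ e, S.origin rate ω e ≤ S.time
  le_clock : ∀ e, S.time ≤ S.clock rate ω e

/-- A queue of positive rate always has a finite next arrival time. -/
lemma clock_ne_top [NeZero n] {rate : Fin n → ℝ} (hr : ∃ i, 0 < rate i) (ω : Sample n)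
    (S : Sim n k) : S.clock rate ω (S.nextEvent rate ω) ≠ ⊤ := by
  obtain ⟨i, hi⟩ := hr
  refine ne_top_of_le_ne_top ?_ ((isFirst_firstEvent (S.clock rate ω)).le (Sum.inl i))
  simp only [clock, Sum.elim_inl, arrivalTime]
  refine ENNReal.div_ne_top ?_ (by simpa using hi)
  exact ENNReal.sum_ne_top.2 fun _ _ => ENNReal.ofReal_ne_top

lemma start_step_of_ne {g : Architecture n} {π : GreedyPolicy n} {S : Sim n k} {e : Event n}
    {t : ℝ≥0∞} {j : Fin n} (h : ¬((S.config.admissible g e).Nonempty ∧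
      j = Config.servingServer e (S.choice g π e t))) : (S.step g π e t).start j = S.start j := by
  simp only [step]
  split_ifs with hA
  · rw [Function.update_of_ne fun h' => h ⟨hA, h'⟩]
  · rfl

lemma start_step_self {g : Architecture n} {π : GreedyPolicy n} {S : Sim n k} {e : Event n}
    {t : ℝ≥0∞} (h : (S.config.admissible g e).Nonempty) :
    (S.step g π e t).start (Config.servingServer e (S.choice g π e t)) = t := by
  simp [step, h]

lemma inv_init (g : Architecture n) (rate : Fin n → ℝ) (ω : Sample n) :
    (init n).Inv g rate ω where
  valid := Config.valid_init g
  time_ne_top := by simp [init]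
  origin_le e := by rcases e with i | j <;> simp [origin, init, Config.init]
  le_clock e := by simp [init]

lemma Inv.step [NeZero n] {g : Architecture n} (π : GreedyPolicy n) {rate : Fin n → ℝ}
    (hr : ∃ i, 0 < rate i) {ω : Sample n} {S : Sim n k} (hS : S.Inv g rate ω) :
    (S.step g π (S.nextEvent rate ω) (S.clock rate ω (S.nextEvent rate ω))).Inv g rate ω := by
  have hmin := (isFirst_firstEvent (S.clock rate ω)).le
  have htop := clock_ne_top hr ω S
  have hle := hS.le_clock (S.nextEvent rate ω)
  change ∀ e', S.clock rate ω (S.nextEvent rate ω) ≤ S.clock rate ω e' at hmin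
  generalize he : S.nextEvent rate ω = e at *
  generalize ht : S.clock rate ω e = t at *
  refine ⟨hS.valid.next fun h => choice_mem h, htop, fun e' => ?_, fun e' => ?_⟩
  · change _ ≤ t
    rcases e' with i | j
    · by_cases hi : e = Sum.inl i
      · subst hi
        rw [← ht]
        simp [origin, Sim.step, Config.arrived_next, clock, arrivalTime]
      · have : (S.step g π e t).origin rate ω (Sum.inl i) = S.origin rate ω (Sum.inl i) := by
          simp [origin, Sim.step, Config.arrived_next, hi]
        rw [this]
        exact (hS.origin_le _).trans hle
    · simp only [origin, Sum.elim_inr]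
      by_cases h : (S.config.admissible g e).Nonempty ∧
        j = Config.servingServer e (S.choice g π e t)
      · rw [h.2, start_step_self h.1]
      · rw [start_step_of_ne h]
        exact (hS.origin_le (Sum.inr j)).trans hle
  · change t ≤ _
    rcases e' with i | j
    · have : S.clock rate ω (Sum.inl i) ≤ (S.step g π e t).clock rate ω (Sum.inl i) := by
        simp only [clock, Sum.elim_inl, arrivalTime, Sim.step, Config.arrived_next]
        gcongr
        omega
      exact (hmin _).trans this
    · by_cases h : (S.config.admissible g e).Nonempty ∧
        j = Config.servingServer e (S.choice g π e t)
      · simp only [clock, Sum.elim_inr, completion]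
        rw [h.2, start_step_self h.1]
        simp only [Sim.step]
        rw [Config.job_next_servingServer _ h.1]
        simp
      · simp only [clock, Sum.elim_inr, completion]
        rw [start_step_of_ne h]
        simp only [Sim.step]
        rw [Config.job_next _ _ _ _ _ h]
        split_ifs
        · simp
        · exact hmin (Sum.inr j)

end Sim

/-! ### The trajectory and its dependence on one variable -/

section run

variable [NeZero n] (g : Architecture n) (π : GreedyPolicy n) (rate : Fin n → ℝ)

/-- The evolution of the system. -/
def sim (ω : Sample n) : (k : ℕ) → Sim n k
  | 0 => Sim.init n
  | k + 1 => (sim ω k).step g π ((sim ω k).nextEvent rate ω)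
      ((sim ω k).clock rate ω ((sim ω k).nextEvent rate ω))

variable {rate}

lemma inv_sim (hr : ∃ i, 0 < rate i) (ω : Sample n) (k : ℕ) :
    (sim g π rate ω k).Inv g rate ω := by
  induction k with
  | zero => exact Sim.inv_init g rate ω
  | succ k ih => exact ih.step π hr

variable {g π}

/-- The evolution of the system up to some event does not depend on the value of the primitive
random variables that are fresh after this event, and depends on the value of those that are active
only through the fact that their clocks have not expired. -/
lemma sim_setVar (hr : ∃ i, 0 < rate i) {ω : Sample n} {k : ℕ} {v : Var n} {x : ℝ}
    (h : (sim g π rate ω k).config.Fresh v ∨ ∃ e, (sim g π rate ω k).config.active e = some v ∧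
      (sim g π rate ω k).time < (sim g π rate ω k).clock rate (setVar v x ω) e) :
    sim g π rate (setVar v x ω) k = sim g π rate ω k := by
  induction k with
  | zero => rfl
  | succ k ih =>
    have hinv := inv_sim g π hr ω k
    set S := sim g π rate ω k with hS
    have hfirst : IsFirst (S.clock rate ω) (S.nextEvent rate ω) := isFirst_firstEvent _
    have hstep : sim g π rate ω (k + 1) = S.step g π (S.nextEvent rate ω)
      (S.clock rate ω (S.nextEvent rate ω)) := rfl
    have hstep' : sim g π rate (setVar v x ω) (k + 1) =
      (sim g π rate (setVar v x ω) k).step g π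
        ((sim g π rate (setVar v x ω) k).nextEvent rate (setVar v x ω))
        ((sim g π rate (setVar v x ω) k).clock rate (setVar v x ω)
          ((sim g π rate (setVar v x ω) k).nextEvent rate (setVar v x ω))) := rfl
    -- If `v` is fresh before the event, no clock sees it. Otherwise `v` was already running before
    -- the event, for some `e' ≠ e`, and is still running after it; changing its value keeps the
    -- clock of `e'` beyond the current time, so `e` still happens first.
    by_cases hf : S.config.Fresh v
    · have hc := Sim.clock_setVar_of_fresh (rate := rate) (ω := ω) hinv.valid hf x
      rw [hstep, hstep', ih (Or.inl hf)]
      simp only [Sim.nextEvent, hc]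
    · rw [hstep] at h ⊢
      generalize he : S.nextEvent rate ω = e at *
      have hp : (S.config.admissible g e).Nonempty →
        S.choice g π e (S.clock rate ω e) ∈ S.config.admissible g e := fun h => Sim.choice_mem h
      obtain ⟨e', hne, ha, ha', hns⟩ := Config.fresh_or_active_of_next (g := g) (e := e)
        (h.imp_right fun ⟨e', h, _⟩ => ⟨e', h⟩) hf
      have hvalid' : (S.config.next g e (S.choice g π e (S.clock rate ω e))).Valid g :=
        hinv.valid.next hp
      -- The clock of `e'` is not restarted by `e`, so its new expiry time can be compared in the
      -- state before the event.
      have horig : (S.step g π e (S.clock rate ω e)).origin rate ω e' = S.origin rate ω e' := by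
        rcases e' with i | j
        · simp [Sim.origin, Sim.step, Config.arrived_next, hne.symm]
        · exact Sim.start_step_of_ne fun h' => hns ⟨h'.1, by rw [← h'.2]⟩
      have hclock : S.clock rate ω e < S.clock rate (setVar v x ω) e' := by
        rcases h with h | ⟨e'', h1, h2⟩
        · exfalso
          rcases v with ⟨i, m⟩ | ⟨i, m⟩
          · rcases e' with i' | j
            · simp only [Config.active, Option.some.injEq, Sum.inl.injEq, Prod.mk.injEq] at ha'
              simp only [Config.Fresh, Sim.step, ← ha'.1, ← ha'.2] at h
              exact lt_irrefl _ h
            · simp [Config.active] at ha'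
          · rcases e' with i' | j
            · simp [Config.active] at ha'
            · simp only [Config.active, Option.map_eq_some_iff, Sum.inr.injEq,
                exists_eq_right] at ha'
              have := hvalid'.lt_fetched _ _ ha'
              simp only [Config.Fresh, Sim.step] at h
              exact absurd this (not_lt.2 h)
        · have : e'' = e' := by
            rcases e'' with i | j <;> rcases e' with i' | j'
            · simp only [Config.active, Option.some.injEq] at h1 ha'
              have := h1.trans ha'.symm
              simp only [Sum.inl.injEq, Prod.mk.injEq] at this
              rw [this.1]
            · simp only [Config.active, Option.some.injEq] at h1
              simp [Config.active, ← h1] at ha'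
            · simp only [Config.active, Option.some.injEq] at ha'
              simp [Config.active, ← ha'] at h1
            · simp only [Config.active, Option.map_eq_some_iff] at h1 ha'
              obtain ⟨q, h1, rfl⟩ := h1
              obtain ⟨q', h3, h4⟩ := ha'
              cases h4
              rw [hvalid'.job_inj _ _ _ h1 h3]
          subst this
          rw [Sim.clock_setVar_self ha', horig, ← Sim.clock_setVar_self ha x] at h2
          exact h2
      have hih := ih (Or.inr ⟨e', ha, (hinv.le_clock e).trans_lt hclock⟩)
      have hse : S.clock rate (setVar v x ω) e = S.clock rate ω e :=
        Sim.clock_setVar_of_active hinv.valid ha hne.symm x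
      have hfirst' : IsFirst (S.clock rate (setVar v x ω)) e := by
        intro e''
        by_cases h' : e'' = e'
        · subst h'
          left
          rw [hse]
          exact hclock
        · rw [hse, Sim.clock_setVar_of_active hinv.valid ha h' x]
          exact hfirst e''
      rw [hstep', hih]
      have : S.nextEvent rate (setVar v x ω) = e := hfirst'.eq
      rw [this, hse]

end run

end Flex

end

noncomputable section

namespace Flex

variable {n : ℕ}

/-! ### Measurability -/

instance : MeasurableSingletonClass (Event n) :=
  ⟨fun _ => measurableSet_sum_iff.2 ⟨MeasurableSet.of_discrete, MeasurableSet.of_discrete⟩⟩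

/-- Configurations, events and choices take countably many values, so measurability can be checked
with these frozen. -/
lemma measurable_countable_index {α β γ : Type*} [MeasurableSpace α] [MeasurableSpace β]
    [MeasurableSpace γ] [Countable α] [MeasurableSingletonClass α] {idx : β → α}
    (h : Measurable idx) {f : α → β → γ} (hf : ∀ a, Measurable (f a)) :
    Measurable fun b => f (idx b) b := by
  have : Measurable fun p : α × β => f p.1 p.2 := measurable_from_prod_countable_right hf
  exact this.comp (h.prodMk measurable_id)

lemma measurable_arrivalTime (rate : Fin n → ℝ) (i : Fin n) (m : ℕ) :
    Measurable fun ω : Sample n => arrivalTime rate ω i m := by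
  unfold arrivalTime
  fun_prop

lemma measurable_jobSize (i : Fin n) (m : ℕ) :
    Measurable fun ω : Sample n => jobSize ω i m := by
  unfold jobSize
  fun_prop

variable {g : Architecture n} {π : GreedyPolicy n} {rate : Fin n → ℝ}

namespace Sim

variable {k : ℕ}

/-- Measurability of a random state. -/
structure IsMeasurable (S : Sample n → Sim n k) : Prop where
  config : Measurable fun ω => (S ω).config
  time : Measurable fun ω => (S ω).time
  start : Measurable fun ω => (S ω).start
  hist : Measurable fun ω => (S ω).hist

lemma IsMeasurable.clock {S : Sample n → Sim n k} (hS : IsMeasurable S) (e : Event n) :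
    Measurable fun ω => (S ω).clock rate ω e := by
  rcases e with i | j
  · exact measurable_countable_index (f := fun (c : Config n) ω => arrivalTime rate ω i (c.arrived i))
      hS.config fun c => measurable_arrivalTime _ _ _
  · refine measurable_countable_index
      (f := fun (c : Config n) ω => (c.job j).elim ⊤ fun q => (S ω).start j + jobSize ω q.1 q.2)
      hS.config fun c => ?_
    rcases c.job j with _ | q
    · exact measurable_const
    · exact ((measurable_pi_apply j).comp hS.start).add (measurable_jobSize _ _)

variable [NeZero n]

lemma IsMeasurable.nextEvent {S : Sample n → Sim n k} (hS : IsMeasurable S) :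
    Measurable fun ω => (S ω).nextEvent rate ω := by
  refine measurable_to_countable' fun e => ?_
  have : (fun ω => (S ω).nextEvent rate ω) ⁻¹' {e} =
      ⋂ e', {ω | (S ω).clock rate ω e < (S ω).clock rate ω e' ∨
        (S ω).clock rate ω e = (S ω).clock rate ω e' ∧ tieRank e ≤ tieRank e'} := by
    ext ω
    simp only [Set.mem_preimage, Set.mem_singleton_iff, Set.mem_iInter, Set.mem_ofPred_eq]
    exact ⟨fun h => h ▸ isFirst_firstEvent _, fun h => IsFirst.eq h⟩
  rw [this]
  refine MeasurableSet.iInter fun e' => ?_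
  exact (measurableSet_lt (hS.clock e) (hS.clock e')).union
    ((measurableSet_eq_fun (hS.clock e) (hS.clock e')).inter (MeasurableSet.const _))

lemma IsMeasurable.clock_nextEvent {S : Sample n → Sim n k} (hS : IsMeasurable S) :
    Measurable fun ω => (S ω).clock rate ω ((S ω).nextEvent rate ω) :=
  measurable_countable_index (f := fun e ω => (S ω).clock rate ω e) hS.nextEvent fun e =>
    hS.clock e

lemma IsMeasurable.nextHist {S : Sample n → Sim n k} (hS : IsMeasurable S) :
    Measurable fun ω => (S ω).nextHist ((S ω).nextEvent rate ω)
      ((S ω).clock rate ω ((S ω).nextEvent rate ω)) := by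
  refine measurable_pi_iff.2 fun l => ?_
  refine Fin.lastCases ?_ (fun l => ?_) l
  · simp only [Sim.nextHist, Fin.snoc_last]
    exact hS.nextEvent.prodMk hS.clock_nextEvent
  · simp only [Sim.nextHist, Fin.snoc_castSucc]
    exact (measurable_pi_apply l).comp hS.hist

lemma IsMeasurable.choice {S : Sample n → Sim n k} (hS : IsMeasurable S) :
    Measurable fun ω => (S ω).choice g π ((S ω).nextEvent rate ω)
      ((S ω).clock rate ω ((S ω).nextEvent rate ω)) := by
  refine measurable_countable_index (idx := fun ω => ((S ω).config, (S ω).nextEvent rate ω))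
    (f := fun (a : Config n × Event n) ω => π.choice ((S ω).nextHist ((S ω).nextEvent rate ω)
      ((S ω).clock rate ω ((S ω).nextEvent rate ω))) (a.1.admissible g a.2) a.2)
    (hS.config.prodMk hS.nextEvent) ?_
  rintro ⟨c, i | j⟩
  · exact (π.measurable_server _ _).comp hS.nextHist
  · exact (π.measurable_queue _ _).comp hS.nextHist

lemma IsMeasurable.step {S : Sample n → Sim n k} (hS : IsMeasurable S) :
    IsMeasurable fun ω => (S ω).step g π ((S ω).nextEvent rate ω)
      ((S ω).clock rate ω ((S ω).nextEvent rate ω)) := by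
  classical
  have hidx := (hS.config.prodMk (hS.nextEvent (rate := rate))).prodMk
    (hS.choice (g := g) (π := π) (rate := rate))
  refine ⟨?_, hS.clock_nextEvent, ?_, hS.nextHist⟩
  · exact measurable_countable_index
      (f := fun (a : (Config n × Event n) × Fin n) _ => a.1.1.next g a.1.2 a.2) hidx
      fun _ => measurable_const
  · refine measurable_countable_index
      (f := fun (a : (Config n × Event n) × Fin n) ω => if (a.1.1.admissible g a.1.2).Nonempty then
        Function.update (S ω).start (Config.servingServer a.1.2 a.2)
          ((S ω).clock rate ω ((S ω).nextEvent rate ω)) else (S ω).start) hidx ?_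
    rintro ⟨⟨c, e⟩, p⟩
    split_ifs
    · refine measurable_pi_iff.2 fun j => ?_
      by_cases h : j = Config.servingServer e p
      · subst h
        simpa using hS.clock_nextEvent
      · simp only [Function.update_of_ne h]
        exact (measurable_pi_apply j).comp hS.start
    · exact hS.start

end Sim

variable [NeZero n] (g π rate)

lemma isMeasurable_sim (k : ℕ) : Sim.IsMeasurable fun ω => sim g π rate ω k := by
  induction k with
  | zero => exact ⟨measurable_const, measurable_const, measurable_const, measurable_const⟩
  | succ k ih => exact ih.step

/-- The configuration after `k` events. -/
def cfg (k : ℕ) (ω : Sample n) : Config n := (sim g π rate ω k).config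

/-- The `k`-th event (counted from `0`). -/
def event (k : ℕ) (ω : Sample n) : Event n := (sim g π rate ω k).nextEvent rate ω

/-- The time between event `k` and the event before it. -/
def gap (k : ℕ) (ω : Sample n) : ℝ≥0∞ :=
  (sim g π rate ω k).clock rate ω (event g π rate k ω) - (sim g π rate ω k).time

lemma measurable_cfg (k : ℕ) : Measurable (cfg g π rate k) := (isMeasurable_sim g π rate k).config

lemma measurable_event (k : ℕ) : Measurable (event g π rate k) :=
  (isMeasurable_sim g π rate k).nextEvent

lemma measurable_gap (k : ℕ) : Measurable (gap g π rate k) :=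
  (isMeasurable_sim g π rate k).clock_nextEvent.sub (isMeasurable_sim g π rate k).time

end Flex

end

noncomputable section

namespace Flex

/-! ### Exponential clocks -/

/-- In the scale of the primitive variable, a time interval of length `N - T` has length `r * (N -
T)`. This is where the rate of the clock enters the intensity. -/
lemma volume_clock_between {b T N : ℝ≥0∞} (hT : T ≠ ⊤) (hN : N ≠ ⊤) (hbT : b ≤ T) {r : ℝ}
    (hr : 0 < r) :
    volume {u : ℝ | 0 < u ∧ T < b + ENNReal.ofReal u / ENNReal.ofReal r ∧
      b + ENNReal.ofReal u / ENNReal.ofReal r < N} = ENNReal.ofReal r * (N - T) := by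
  have hb : b ≠ ⊤ := ne_top_of_le_ne_top hT hbT
  lift b to NNReal using hb
  lift T to NNReal using hT
  lift N to NNReal using hN
  have hbT' : (b : ℝ) ≤ T := by exact_mod_cast hbT
  have hcl : ∀ u : ℝ, 0 < u → (b : ℝ≥0∞) + ENNReal.ofReal u / ENNReal.ofReal r =
      ENNReal.ofReal (b + u / r) := by
    intro u hu
    rw [← ENNReal.ofReal_div_of_pos hr, ENNReal.ofReal_add (NNReal.coe_nonneg b) (by positivity),
      ENNReal.ofReal_coe_nnreal]
  have : {u : ℝ | 0 < u ∧ (T : ℝ≥0∞) < b + ENNReal.ofReal u / ENNReal.ofReal r ∧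
      b + ENNReal.ofReal u / ENNReal.ofReal r < N} = Set.Ioo (r * (T - b)) (r * (N - b)) := by
    ext u
    simp only [Set.mem_ofPred_eq, Set.mem_Ioo]
    have key : ∀ hu : 0 < u, ((T : ℝ≥0∞) < b + ENNReal.ofReal u / ENNReal.ofReal r ∧
        b + ENNReal.ofReal u / ENNReal.ofReal r < N) ↔ r * (T - b) < u ∧ u < r * (N - b) := by
      intro hu
      rw [hcl u hu, ← ENNReal.ofReal_coe_nnreal (p := T), ← ENNReal.ofReal_coe_nnreal (p := N),
        ENNReal.ofReal_lt_ofReal_iff (by positivity),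
        ENNReal.ofReal_lt_ofReal_iff_of_nonneg (by positivity), ← lt_div_iff₀' hr,
        ← div_lt_iff₀' hr]
      constructor <;> rintro ⟨h1, h2⟩ <;> constructor <;> linarith
    constructor
    · rintro ⟨hu, h⟩; exact (key hu).1 h
    · intro h
      have hu : 0 < u := lt_of_le_of_lt (mul_nonneg hr.le (sub_nonneg.2 hbT')) h.1
      exact ⟨hu, (key hu).2 h⟩
  rw [this, Real.volume_Ioo, ← ENNReal.ofReal_coe_nnreal (p := T),
    ← ENNReal.ofReal_coe_nnreal (p := N), ← ENNReal.ofReal_sub _ (NNReal.coe_nonneg T),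
    ← ENNReal.ofReal_mul hr.le]
  congr 1; ring

lemma clock_strictMono {b : ℝ≥0∞} (hb : b ≠ ⊤) {r : ℝ} (hr : 0 < r) {u x : ℝ}
    (hx : 0 < x) : b + ENNReal.ofReal u / ENNReal.ofReal r <
      b + ENNReal.ofReal x / ENNReal.ofReal r ↔ u < x := by
  rw [ENNReal.add_lt_add_iff_left hb, ENNReal.div_lt_div_iff_left (by simpa using hr)
    ENNReal.ofReal_ne_top, ENNReal.ofReal_lt_ofReal_iff hx]

lemma ae_clock_ne {b : ℝ≥0∞} (hb : b ≠ ⊤) {r : ℝ} (hr : 0 < r) (c : ℝ≥0∞) :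
    ∀ᵐ x ∂(expMeasure 1), b + ENNReal.ofReal x / ENNReal.ofReal r ≠ c := by
  have hs : {x : ℝ | 0 < x ∧ b + ENNReal.ofReal x / ENNReal.ofReal r = c}.Subsingleton := by
    rintro x ⟨hx, hxc⟩ y ⟨hy, hyc⟩
    have h := hxc.trans hyc.symm
    exact le_antisymm (not_lt.1 fun h' => h.symm.not_lt ((clock_strictMono hb hr hx).2 h'))
      (not_lt.1 fun h' => h.not_lt ((clock_strictMono hb hr hy).2 h'))
  have h0 : expMeasure 1 {x : ℝ | 0 < x ∧ b + ENNReal.ofReal x / ENNReal.ofReal r = c} = 0 :=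
    hs.measure_zero _
  filter_upwards [ae_pos_expMeasure_one, measure_eq_zero_iff_ae_notMem.1 h0] with x hx h h'
  exact h ⟨hx, h'⟩

lemma exists_lt_clock (b : ℝ≥0∞) {r : ℝ} (hr : 0 < r) {c : ℝ≥0∞} (hc : c ≠ ⊤) :
    ∃ y₀ : ℝ, ∀ y, y₀ ≤ y → c < b + ENNReal.ofReal y / ENNReal.ofReal r := by
  refine ⟨r * (c.toReal + 1), fun y hy => ?_⟩
  have h1 : c < ENNReal.ofReal (y / r) := by
    rw [ENNReal.lt_ofReal_iff_toReal_lt hc, lt_div_iff₀' hr]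
    nlinarith
  rw [← ENNReal.ofReal_div_of_pos hr]
  exact h1.trans_le le_add_self

variable {n : ℕ} [NeZero n] {g : Architecture n} {π : GreedyPolicy n} {rate : Fin n → ℝ}

omit [NeZero n] in
lemma Sim.origin_setVar {k : ℕ} {ω : Sample n} {S : Sim n k} {e : Event n} {v : Var n}
    (h : S.config.active e = some v) (x : ℝ) :
    S.origin rate (setVar v x ω) e = S.origin rate ω e := by
  have h1 := Sim.clock_setVar_self (rate := rate) (ω := setVar v x ω) h 0
  rw [setVar_setVar, Sim.clock_setVar_self h] at h1
  simpa using h1.symm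

/-- As a function of a single primitive random variable `v`, the state in which `v` is active is
constant, and this state is reached as soon as the clock of `v` exceeds its time. -/
lemma exists_state_of_active (hr : ∃ i, 0 < rate i) (ω : Sample n) (k : ℕ) (v : Var n)
    {e : Event n} (he : 0 < Sim.eventRate rate e) :
    (∀ x, (cfg g π rate k (setVar v x ω)).active e ≠ some v) ∨
    ∃ S : Sim n k, S.time ≠ ⊤ ∧ S.origin rate ω e ≤ S.time ∧ S.config.active e = some v ∧
      S.config.Valid g ∧ ∀ x,
      (S.time < S.clock rate (setVar v x ω) e → sim g π rate (setVar v x ω) k = S) ∧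
      ((cfg g π rate k (setVar v x ω)).active e = some v →
        sim g π rate (setVar v x ω) k = S ∧ S.time ≤ S.clock rate (setVar v x ω) e) := by
  by_cases hx₀ : ∃ x₀, (cfg g π rate k (setVar v x₀ ω)).active e = some v
  swap
  · left; push Not at hx₀; exact hx₀
  right
  obtain ⟨x₀, hx₀⟩ := hx₀
  have hreach : ∀ x, (cfg g π rate k (setVar v x ω)).active e = some v → ∀ y,
      (sim g π rate (setVar v x ω) k).time <
        (sim g π rate (setVar v x ω) k).clock rate (setVar v y ω) e →
      sim g π rate (setVar v y ω) k = sim g π rate (setVar v x ω) k := by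
    intro x hx y hy
    have := sim_setVar (g := g) (π := π) (k := k) hr (ω := setVar v x ω) (v := v) (x := y)
      (Or.inr ⟨e, hx, by rw [setVar_setVar]; exact hy⟩)
    rwa [setVar_setVar] at this
  have hinv := fun x => inv_sim g π hr (setVar v x ω) k
  refine ⟨sim g π rate (setVar v x₀ ω) k, (hinv x₀).time_ne_top, ?_, hx₀, (hinv x₀).valid,
    fun x => ⟨hreach x₀ hx₀ x, fun hx => ?_⟩⟩
  · rw [← Sim.origin_setVar (ω := ω) hx₀ x₀]
    exact (hinv x₀).origin_le e
  · have heq : sim g π rate (setVar v x ω) k = sim g π rate (setVar v x₀ ω) k := by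
      obtain ⟨y₁, h₁⟩ := exists_lt_clock
        ((sim g π rate (setVar v x ω) k).origin rate ω e) he (hinv x).time_ne_top
      obtain ⟨y₂, h₂⟩ := exists_lt_clock
        ((sim g π rate (setVar v x₀ ω) k).origin rate ω e) he (hinv x₀).time_ne_top
      rw [← hreach x hx (max y₁ y₂), ← hreach x₀ hx₀ (max y₁ y₂)]
      · rw [Sim.clock_setVar_self hx₀]; exact h₂ _ (le_max_right _ _)
      · rw [Sim.clock_setVar_self hx]; exact h₁ _ (le_max_left _ _)
    refine ⟨heq, ?_⟩
    rw [← heq]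
    exact (hinv x).le_clock e

-- The core of the compensation formula. With all variables but `v` frozen, the state `S` in which
-- `v` is running is fixed, and so is the first competing time `M`. Event `e` happens when the clock
-- of `v` expires between `S.time` and `M`, that is, when `v` lies in an interval `I`; the rate
-- times the gap is the length of the part of `I` below `v`. The two means agree because the hazard
-- rate is `1`.
open Classical in
lemma lintegral_event_active (hr : ∃ i, 0 < rate i) (k : ℕ) (v : Var n)
    {e : Event n} (he : 0 < Sim.eventRate rate e) (G : Config n → ℝ≥0∞) :
    ∫⁻ ω, (if (cfg g π rate k ω).active e = some v ∧ event g π rate k ω = e then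
      G (cfg g π rate k ω) else 0) ∂(law n) =
    ∫⁻ ω, ENNReal.ofReal (Sim.eventRate rate e) *
      ((if (cfg g π rate k ω).active e = some v then G (cfg g π rate k ω) else 0) *
        gap g π rate k ω) ∂(law n) := by
  have hmF : Measurable fun ω => if (cfg g π rate k ω).active e = some v ∧
      event g π rate k ω = e then G (cfg g π rate k ω) else 0 :=
    (Measurable.of_discrete (f := fun p : Config n × Event n =>
      if p.1.active e = some v ∧ p.2 = e then G p.1 else 0)).comp
      ((measurable_cfg g π rate k).prodMk (measurable_event g π rate k))
  have hmG : Measurable fun ω => ENNReal.ofReal (Sim.eventRate rate e) *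
      ((if (cfg g π rate k ω).active e = some v then G (cfg g π rate k ω) else 0) *
        gap g π rate k ω) := by
    refine Measurable.const_mul (Measurable.mul ?_ (measurable_gap g π rate k)) _
    exact (Measurable.of_discrete (f := fun c : Config n =>
      if c.active e = some v then G c else 0)).comp (measurable_cfg g π rate k)
  rw [lintegral_eq_lintegral_setVar v hmF, lintegral_eq_lintegral_setVar v hmG]
  refine lintegral_congr fun ω => ?_
  rcases exists_state_of_active (g := g) (π := π) hr ω k v he with h | ⟨S, hT, hoT, ha, hval, hS⟩
  · simp [h]
  set r := Sim.eventRate rate e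
  set b := S.origin rate ω e
  have hb : b ≠ ⊤ := ne_top_of_le_ne_top hT hoT
  set M : ℝ≥0∞ := ⨅ e' : {e' // e' ≠ e}, S.clock rate ω e'
  set I : Set ℝ := {u : ℝ | 0 < u ∧ S.time < b + ENNReal.ofReal u / ENNReal.ofReal r ∧
      b + ENNReal.ofReal u / ENNReal.ofReal r < M}
  have hcl : ∀ x, S.clock rate (setVar v x ω) e = b + ENNReal.ofReal x / ENNReal.ofReal r :=
    fun x => Sim.clock_setVar_self ha x
  have hcl' : ∀ x e', e' ≠ e → S.clock rate (setVar v x ω) e' = S.clock rate ω e' :=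
    fun x e' h => Sim.clock_setVar_of_active hval ha h x
  have hI : MeasurableSet I := by
    refine measurableSet_Ioi.inter (MeasurableSet.inter ?_ ?_)
    · exact measurableSet_lt (f := fun _ => S.time)
        (g := fun u : ℝ => b + ENNReal.ofReal u / ENNReal.ofReal r) (by fun_prop) (by fun_prop)
    · exact measurableSet_lt (g := fun _ => M)
        (f := fun u : ℝ => b + ENNReal.ofReal u / ENNReal.ofReal r) (by fun_prop) (by fun_prop)
  have hvol : ∀ x, 0 < x → volume (I ∩ Set.Iio x) = ENNReal.ofReal r *
      (min (b + ENNReal.ofReal x / ENNReal.ofReal r) M - S.time) := by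
    intro x hx
    rw [← volume_clock_between hT _ hoT he]
    · congr 1
      ext u
      simp only [I, Set.mem_inter_iff, Set.mem_ofPred_eq, Set.mem_Iio, lt_min_iff,
        clock_strictMono hb he hx]
      tauto
    · refine ne_top_of_le_ne_top ?_ (min_le_left _ _)
      exact ENNReal.add_ne_top.2 ⟨hb, ENNReal.div_ne_top ENNReal.ofReal_ne_top (by simpa using he)⟩
  -- Up to null boundary values there are three cases: the clock expires before `S.time` and `v` is
  -- not running; it expires before `M` and `e` is next; or a competitor is next and the gap is `M -
  -- S.time`.
  have hkey : ∀ᵐ x ∂(expMeasure 1),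
      (if (cfg g π rate k (setVar v x ω)).active e = some v ∧ event g π rate k (setVar v x ω) = e
        then G (cfg g π rate k (setVar v x ω)) else 0) = G S.config * I.indicator 1 x ∧
      ENNReal.ofReal r * ((if (cfg g π rate k (setVar v x ω)).active e = some v then
        G (cfg g π rate k (setVar v x ω)) else 0) * gap g π rate k (setVar v x ω)) =
        G S.config * volume (I ∩ Set.Iio x) := by
    filter_upwards [ae_pos_expMeasure_one, ae_clock_ne hb he S.time, ae_clock_ne hb he M]
      with x hx hxT hxM
    rw [hvol x hx]
    rcases lt_or_gt_of_ne hxT with hlt | hgt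
    · have hna : (cfg g π rate k (setVar v x ω)).active e ≠ some v := by
        intro h
        have := ((hS x).2 h).2
        rw [hcl] at this
        exact hlt.not_ge this
      have hnI : x ∉ I := fun h => hlt.not_gt h.2.1
      have h0 : min (b + ENNReal.ofReal x / ENNReal.ofReal r) M - S.time = 0 :=
        tsub_eq_zero_of_le ((min_le_left _ _).trans hlt.le)
      simp [hna, hnI, h0]
    · have hsim : sim g π rate (setVar v x ω) k = S := (hS x).1 (by rw [hcl]; exact hgt)
      have hcfg : cfg g π rate k (setVar v x ω) = S.config := by rw [cfg, hsim]
      have hev : event g π rate k (setVar v x ω) = S.nextEvent rate (setVar v x ω) := by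
        rw [event, hsim]
      have hgap : gap g π rate k (setVar v x ω) =
          S.clock rate (setVar v x ω) (event g π rate k (setVar v x ω)) - S.time := by
        rw [gap, hsim]
      rw [hcfg]
      rcases lt_or_gt_of_ne hxM with hlt' | hgt'
      · have hfirst : IsFirst (S.clock rate (setVar v x ω)) e := by
          intro e'
          by_cases h : e' = e
          · subst h; right; simp
          · left
            rw [hcl, hcl' x e' h]
            exact hlt'.trans_le (iInf_le (fun e' : {e' // e' ≠ e} => S.clock rate ω e') ⟨e', h⟩)
        have hee : event g π rate k (setVar v x ω) = e := by rw [hev]; exact hfirst.eq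
        have hxI : x ∈ I := ⟨hx, hgt, hlt'⟩
        rw [hgap, hee, hcl, min_eq_left hlt'.le]
        simp only [ha, hxI, Set.indicator_of_mem, true_and, if_true, Pi.one_apply, mul_one]
        ring
      · have hnI : x ∉ I := fun h => hgt'.not_gt h.2.2
        have hmin := (isFirst_firstEvent (S.clock rate (setVar v x ω))).le
        change ∀ e', S.clock rate (setVar v x ω) (S.nextEvent rate (setVar v x ω)) ≤ _ at hmin
        rw [← hev] at hmin
        have hne : event g π rate k (setVar v x ω) ≠ e := by
          intro h
          rw [h, hcl] at hmin
          obtain ⟨e', he'⟩ := iInf_lt_iff.1 hgt'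
          have := hmin e'
          rw [hcl' x e' e'.2] at this
          exact he'.not_ge this
        have hM : S.clock rate (setVar v x ω) (event g π rate k (setVar v x ω)) = M := by
          refine le_antisymm (le_iInf fun e' => ?_) ?_
          · rw [← hcl' x e' e'.2]; exact hmin e'
          · rw [hcl' x _ hne]
            exact iInf_le (fun e' : {e' // e' ≠ e} => S.clock rate ω e') ⟨_, hne⟩
        rw [hgap, hM, min_eq_right hgt'.le]
        simp only [ha, hnI, hne, if_true, and_false, if_false, Set.indicator_of_notMem,
          not_false_eq_true, mul_zero, true_and]
        ring
  rw [lintegral_congr_ae (hkey.mono fun x h => h.1), lintegral_congr_ae (hkey.mono fun x h => h.2),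
    lintegral_const_mul _ (measurable_one.indicator hI), lintegral_indicator_one hI,
    lintegral_const_mul, lintegral_volume_inter_Iio_expMeasure_one hI fun u hu => hu.1.le]
  refine Monotone.measurable fun x y hxy => measure_mono ?_
  exact Set.inter_subset_inter_right _ (Set.Iio_subset_Iio hxy)

omit [NeZero n] in
-- Since `0 / 0 = 0` in `ℝ≥0∞`, a queue of rate `0` has infinite arrival times only where its first
-- interarrival variable is positive, which holds almost surely.
lemma ae_arrivalTime_eq_top (rate : Fin n → ℝ) :
    ∀ᵐ ω ∂(law n), ∀ i m, rate i ≤ 0 → arrivalTime rate ω i m = ⊤ := by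
  rw [ae_all_iff]; intro i
  have h : ∀ᵐ ω ∂(law n), 0 < ω.1 (i, 0) := by
    have h1 : MeasurePreserving (fun ω : Sample n => ω.1 (i, 0)) (law n) (expMeasure 1) :=
      (measurePreserving_eval_infinitePi (fun _ : Fin n × ℕ => expMeasure 1) (i, 0)).comp
        measurePreserving_fst
    exact h1.quasiMeasurePreserving.ae ae_pos_expMeasure_one
  filter_upwards [h] with ω hω m hi
  rw [arrivalTime, ENNReal.ofReal_eq_zero.2 hi, ENNReal.div_zero]
  rw [Finset.sum_range_succ']
  simpa using fun _ => hω

open Classical in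
/-- The rate at which an event of each type happens. -/
def intensity (rate : Fin n → ℝ) (c : Config n) (e : Event n) : ℝ≥0∞ :=
  if c.active e = none then 0 else ENNReal.ofReal (Sim.eventRate rate e)

-- The previous formula is summed over the countably many variables that may drive `e`. An idle
-- server has no such variable, but its clock is `⊤` and never comes first; a queue of rate `0`
-- almost surely produces no event.
open Classical in
lemma lintegral_event_eq (hr : ∃ i, 0 < rate i) (k : ℕ) (e : Event n) (G : Config n → ℝ≥0∞) :
    ∫⁻ ω, (if event g π rate k ω = e then G (cfg g π rate k ω) else 0) ∂(law n) =
    ∫⁻ ω, intensity rate (cfg g π rate k ω) e * G (cfg g π rate k ω) *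
        gap g π rate k ω ∂(law n) := by
  have htop : ∀ ω, event g π rate k ω = e → (sim g π rate ω k).clock rate ω e ≠ ⊤ := by
    rintro ω rfl
    exact Sim.clock_ne_top hr _ _
  by_cases he : 0 < Sim.eventRate rate e
  · have h1 : ∀ ω, (if event g π rate k ω = e then G (cfg g π rate k ω) else 0) =
        ∑' v : Var n, if (cfg g π rate k ω).active e = some v ∧ event g π rate k ω = e then
          G (cfg g π rate k ω) else 0 := by
      intro ω
      rcases ha : (cfg g π rate k ω).active e with _ | v
      · have : event g π rate k ω ≠ e := fun h =>
          htop ω h (Sim.clock_eq_top_of_active_eq_none ha)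
        simp [this]
      · rw [tsum_eq_single v]
        · simp
        · intro v' hv'
          simp [Ne.symm hv']
    have h2 : ∀ ω, intensity rate (cfg g π rate k ω) e * G (cfg g π rate k ω) *
        gap g π rate k ω = ∑' v : Var n, ENNReal.ofReal (Sim.eventRate rate e) *
      ((if (cfg g π rate k ω).active e = some v then G (cfg g π rate k ω) else 0) *
        gap g π rate k ω) := by
      intro ω
      rcases ha : (cfg g π rate k ω).active e with _ | v
      · simp [intensity, ha]
      · rw [tsum_eq_single v]
        · simp [intensity, ha, mul_assoc]
        · intro v' hv'
          simp [Ne.symm hv']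
    simp_rw [h1, h2]
    rw [lintegral_tsum, lintegral_tsum]
    · exact tsum_congr fun v => lintegral_event_active hr k v he G
    · intro v
      refine (Measurable.const_mul (Measurable.mul ?_ (measurable_gap g π rate k)) _).aemeasurable
      exact (Measurable.of_discrete (f := fun c : Config n =>
        if c.active e = some v then G c else 0)).comp (measurable_cfg g π rate k)
    · intro v
      exact ((Measurable.of_discrete (f := fun p : Config n × Event n =>
        if p.1.active e = some v ∧ p.2 = e then G p.1 else 0)).comp
        ((measurable_cfg g π rate k).prodMk (measurable_event g π rate k))).aemeasurable
  · have h0 : ∀ ω, intensity rate (cfg g π rate k ω) e = 0 := by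
      intro ω
      simp [intensity, ENNReal.ofReal_eq_zero.2 (not_lt.1 he)]
    simp_rw [h0, zero_mul]
    rw [lintegral_zero]
    refine lintegral_eq_zero_of_ae_eq_zero ?_
    filter_upwards [ae_arrivalTime_eq_top rate] with ω hω
    rcases e with i | j
    · have : event g π rate k ω ≠ Sum.inl i := fun h => htop ω h (hω i _ (not_lt.1 he))
      simp [this]
    · simp [Sim.eventRate] at he

/-- The intensities of the events, as a compensation formula. -/
theorem lintegral_event (hr : ∃ i, 0 < rate i) (k : ℕ) (φ : Config n → Event n → ℝ≥0∞) :
    ∫⁻ ω, φ (cfg g π rate k ω) (event g π rate k ω) ∂(law n) =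
    ∫⁻ ω, (∑ e, intensity rate (cfg g π rate k ω) e * φ (cfg g π rate k ω) e) *
        gap g π rate k ω ∂(law n) := by
  classical
  have h1 : ∀ ω, φ (cfg g π rate k ω) (event g π rate k ω) =
      ∑ e, if event g π rate k ω = e then φ (cfg g π rate k ω) e else 0 := by
    intro ω; simp
  simp_rw [h1, Finset.sum_mul]
  rw [lintegral_finsetSum, lintegral_finsetSum]
  · exact Finset.sum_congr rfl fun e _ => lintegral_event_eq hr k e fun c => φ c e
  · intro e _
    refine Measurable.mul ?_ (measurable_gap g π rate k)
    exact (Measurable.of_discrete (f := fun c : Config n => intensity rate c e * φ c e)).comp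
      (measurable_cfg g π rate k)
  · intro e _
    exact (Measurable.of_discrete (f := fun p : Config n × Event n =>
        if p.2 = e then φ p.1 e else 0)).comp
        ((measurable_cfg g π rate k).prodMk (measurable_event g π rate k))

/-! ### Absence of ties -/

/-- Given all other variables, the clock of `e` has no atoms while the clock of `e'` is fixed. Only
finite ties are excluded: idle servers all share the value `⊤`. -/
lemma ae_clock_ne_clock (hr : ∃ i, 0 < rate i) (k : ℕ) {e e' : Event n} (hne : e' ≠ e) :
    ∀ᵐ ω ∂(law n), (sim g π rate ω k).clock rate ω e = (sim g π rate ω k).clock rate ω e' →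
      (sim g π rate ω k).clock rate ω e = ⊤ := by
  by_cases he : 0 < Sim.eventRate rate e
  · have hv : ∀ v : Var n, ∀ᵐ ω ∂(law n), ¬((cfg g π rate k ω).active e = some v ∧
        (sim g π rate ω k).clock rate ω e = (sim g π rate ω k).clock rate ω e') := by
      intro v
      have hm : MeasurableSet {ω | (cfg g π rate k ω).active e = some v ∧
          (sim g π rate ω k).clock rate ω e = (sim g π rate ω k).clock rate ω e'} := by
        refine MeasurableSet.inter ?_ (measurableSet_eq_fun ((isMeasurable_sim g π rate k).clock e)
          ((isMeasurable_sim g π rate k).clock e'))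
        exact measurable_cfg g π rate k (MeasurableSet.of_discrete (s := {c | c.active e = some v}))
      refine measure_eq_zero_iff_ae_notMem.1 (?_ : law n {ω | (cfg g π rate k ω).active e = some v ∧
          (sim g π rate ω k).clock rate ω e = (sim g π rate ω k).clock rate ω e'} = 0)
      rw [← lintegral_indicator_one hm,
        lintegral_eq_lintegral_setVar v (measurable_one.indicator hm)]
      refine lintegral_eq_zero_of_ae_eq_zero (Eventually.of_forall fun ω => ?_)
      refine lintegral_eq_zero_of_ae_eq_zero ?_
      rcases exists_state_of_active (g := g) (π := π) hr ω k v he with h | ⟨S, hT, hoT, ha, hval, hS⟩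
      · exact Eventually.of_forall fun x => by simp [h]
      · filter_upwards [ae_clock_ne (ne_top_of_le_ne_top hT hoT) he (S.clock rate ω e')] with x hx
        apply Set.indicator_of_notMem
        rintro ⟨h1, h2⟩
        rw [((hS x).2 h1).1, Sim.clock_setVar_self ha,
          Sim.clock_setVar_of_active hval ha hne x] at h2
        exact hx h2
    filter_upwards [ae_all_iff.2 hv] with ω hω heq
    rcases ha : (cfg g π rate k ω).active e with _ | v
    · exact Sim.clock_eq_top_of_active_eq_none ha
    · exact absurd ⟨ha, heq⟩ (hω v)
  · filter_upwards [ae_arrivalTime_eq_top rate] with ω hω _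
    rcases e with i | j
    · exact hω i _ (not_lt.1 he)
    · simp [Sim.eventRate] at he

/-! ### Agreement of the simulation with `run` -/

/-- The state of the system, with the completion times. -/
def Sim.toState {k : ℕ} (ω : Sample n) (S : Sim n k) : State n :=
  ⟨S.time, S.config.arrived, S.config.fetched, S.completion ω⟩

omit [NeZero n] in
lemma Sim.completion_eq_top_iff {k : ℕ} {ω : Sample n} {S : Sim n k} (hS : S.Inv g rate ω)
    (j : Fin n) : S.completion ω j = ⊤ ↔ S.config.job j = none := by
  have : S.start j ≠ ⊤ := ne_top_of_le_ne_top hS.time_ne_top (hS.origin_le (Sum.inr j))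
  rcases h : S.config.job j with _ | q
  · simp [completion, h]
  · simp [completion, h, this, jobSize]

open Classical in
omit [NeZero n] in
lemma State.step_inl {ω : Sample n} {s : State n} {i : Fin n} {t : ℝ≥0∞} {k : ℕ} {h : History n k}
    {A : Finset (Fin n)} (hA : ∀ j, j ∈ A ↔ (i, j) ∈ g ∧ s.completion j = ⊤) :
    s.step g π ω (Sum.inl i) t h =
      if A.Nonempty then
        State.startService ω { s with
          time := t
          arrived := Function.update s.arrived i (s.arrived i + 1) } i (π.server k h A)
      else { s with
        time := t
        arrived := Function.update s.arrived i (s.arrived i + 1) } := by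
  obtain rfl : A = Finset.univ.filter fun j => (i, j) ∈ g ∧ s.completion j = ⊤ := by
    ext j; simp [hA j]
  rfl

open Classical in
omit [NeZero n] in
lemma State.step_inr {ω : Sample n} {s : State n} {j : Fin n} {t : ℝ≥0∞} {k : ℕ} {h : History n k}
    {A : Finset (Fin n)} (hA : ∀ i, i ∈ A ↔ (i, j) ∈ g ∧ s.fetched i < s.arrived i) :
    s.step g π ω (Sum.inr j) t h =
      if A.Nonempty then
        State.startService ω { s with
          time := t
          completion := Function.update s.completion j ⊤ } (π.queue k h A) j
      else { s with
        time := t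
        completion := Function.update s.completion j ⊤ } := by
  obtain rfl : A = Finset.univ.filter fun i => (i, j) ∈ g ∧ s.fetched i < s.arrived i := by
    ext i; simp [hA i]
  rfl

omit [NeZero n] in
lemma Sim.step_toState {k : ℕ} {ω : Sample n} {S : Sim n k} (hS : S.Inv g rate ω) (e : Event n)
    (t : ℝ≥0∞) : (S.toState ω).step g π ω e t (S.nextHist e t) = (S.step g π e t).toState ω := by
  classical
  rcases e with i | j
  · rw [State.step_inl (A := S.config.admissible g (Sum.inl i)) (by
      intro j; simp [Config.admissible, toState, completion_eq_top_iff hS])]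
    by_cases h : (S.config.admissible g (Sum.inl i)).Nonempty
    · simp only [h, if_true, State.startService, Sim.step, Config.next, Config.record, Config.serve,
        Config.servedQueue, Config.servingServer, Sum.elim_inl, id, State.mk.injEq, true_and,
        choice, GreedyPolicy.choice, toState]
      funext j
      by_cases hj : j = π.server (k + 1) (S.nextHist (Sum.inl i) t)
          (S.config.admissible g (Sum.inl i))
      · subst hj; simp [completion]
      · simp [completion, hj]
    · simp only [h, if_false, Sim.step, Config.next, Config.record, toState]
      rfl
  · rw [State.step_inr (A := S.config.admissible g (Sum.inr j)) (by
      intro j; simp [Config.admissible, toState])]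
    by_cases h : (S.config.admissible g (Sum.inr j)).Nonempty
    · simp only [h, if_true, State.startService, Sim.step, Config.next, Config.record, Config.serve,
        Config.servedQueue, Config.servingServer, Sum.elim_inr, id, State.mk.injEq, true_and,
        choice, GreedyPolicy.choice, toState]
      funext j'
      by_cases hj : j' = j
      · subst hj; simp [completion]
      · simp [completion, hj]
    · simp only [h, if_false, Sim.step, Config.next, Config.record, toState, State.mk.injEq,
        true_and]
      funext j'
      by_cases hj : j' = j
      · subst hj; simp [completion]
      · simp [completion, hj]

variable (g π)

/-- Almost surely, the way in which ties are broken does not matter. -/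
theorem ae_run_eq (hr : ∃ i, 0 < rate i) : ∀ᵐ ω ∂(law n), ∀ k,
    (run g π rate ω k).1 = (sim g π rate ω k).toState ω := by
  have hties : ∀ᵐ ω ∂(law n), ∀ k e e', e' ≠ e →
      (sim g π rate ω k).clock rate ω e = (sim g π rate ω k).clock rate ω e' →
      (sim g π rate ω k).clock rate ω e = ⊤ := by
    simp_rw [ae_all_iff]
    exact fun k e e' hne => ae_clock_ne_clock hr k hne
  filter_upwards [hties] with ω hω k
  suffices h : run g π rate ω k = ((sim g π rate ω k).toState ω, (sim g π rate ω k).hist) by rw [h]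
  induction k with
  | zero => rfl
  | succ k ih =>
    set S := sim g π rate ω k with hS
    have hnext : (S.toState ω).nextEvent rate ω = S.nextEvent rate ω := by
      by_contra hne
      have h1 : ∀ e, S.clock rate ω ((S.toState ω).nextEvent rate ω) ≤ S.clock rate ω e :=
        Classical.choose_spec (Finite.exists_min ((S.toState ω).clock rate ω))
      have h2 := (isFirst_firstEvent (S.clock rate ω)).le ((S.toState ω).nextEvent rate ω)
      exact Sim.clock_ne_top hr ω S (hω k _ _ hne (le_antisymm h2 (h1 _)))
    have hclock : (S.toState ω).clock rate ω = S.clock rate ω := rfl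
    have hrun : run g π rate ω (k + 1) =
        ((S.toState ω).step g π ω ((S.toState ω).nextEvent rate ω)
          ((S.toState ω).clock rate ω ((S.toState ω).nextEvent rate ω))
          (S.nextHist ((S.toState ω).nextEvent rate ω)
            ((S.toState ω).clock rate ω ((S.toState ω).nextEvent rate ω))),
          S.nextHist ((S.toState ω).nextEvent rate ω)
            ((S.toState ω).clock rate ω ((S.toState ω).nextEvent rate ω))) := by
      simp only [run, ih]
      rfl
    rw [hrun, hnext, hclock, Sim.step_toState (inv_sim g π hr ω k)]
    rfl

end Flex

end

noncomputable section

namespace Flex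

variable {n : ℕ}

/-! ### Clusters -/

/-- A set `A` of queues and a set `B` of `d` servers that are completely connected to each other,
and not connected to the rest of the system. -/
structure IsCluster (g : Architecture n) (A B : Finset (Fin n)) (d : ℕ) : Prop where
  mem_iff : ∀ i j, (i, j) ∈ g → (i ∈ A ↔ j ∈ B)
  adj : ∀ i ∈ A, ∀ j ∈ B, (i, j) ∈ g
  card : B.card = d

namespace Config

open Classical in
/-- The number of busy servers in `B`. -/
def busyCount (B : Finset (Fin n)) (c : Config n) : ℕ := ∑ j ∈ B, if c.job j = none then 0 else 1

/-- The number of jobs waiting in the queues in `A`. -/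
def waitingCount (A : Finset (Fin n)) (c : Config n) : ℕ := ∑ i ∈ A, (c.arrived i - c.fetched i)

/-- The number of jobs in a cluster. -/
def load (A B : Finset (Fin n)) (c : Config n) : ℕ := c.waitingCount A + c.busyCount B

variable {g : Architecture n} {A B : Finset (Fin n)} {d : ℕ}

lemma waitingCount_arrive {c : Config n} {i : Fin n} (h : c.fetched i ≤ c.arrived i) :
    (c.record (Sum.inl i)).waitingCount A = c.waitingCount A + if i ∈ A then 1 else 0 := by
  unfold waitingCount
  rw [← Finset.sum_ite_eq' A i fun _ => 1, ← Finset.sum_add_distrib]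
  refine Finset.sum_congr rfl fun i' _ => ?_
  by_cases hi : i' = i
  · subst hi; simp [record]; omega
  · simp [record, hi]

lemma busyCount_complete {c : Config n} {j : Fin n} (h : c.job j ≠ none) :
    (c.record (Sum.inr j)).busyCount B + (if j ∈ B then 1 else 0) = c.busyCount B := by
  classical
  unfold busyCount
  rw [← Finset.sum_ite_eq' B j fun _ => 1, ← Finset.sum_add_distrib]
  refine Finset.sum_congr rfl fun j' _ => ?_
  by_cases hj : j' = j
  · subst hj; simp [record, h]
  · simp [record, hj]

lemma waitingCount_serve {c : Config n} {i : Fin n} (j : Fin n) (h : c.fetched i < c.arrived i) :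
    (c.serve i j).waitingCount A + (if i ∈ A then 1 else 0) = c.waitingCount A := by
  unfold waitingCount
  rw [← Finset.sum_ite_eq' A i fun _ => 1, ← Finset.sum_add_distrib]
  refine Finset.sum_congr rfl fun i' _ => ?_
  by_cases hi : i' = i
  · subst hi; simp [serve]; omega
  · simp [serve, hi]

lemma busyCount_serve {c : Config n} (i : Fin n) {j : Fin n} (h : c.job j = none) :
    (c.serve i j).busyCount B = c.busyCount B + if j ∈ B then 1 else 0 := by
  classical
  unfold busyCount
  rw [← Finset.sum_ite_eq' B j fun _ => 1, ← Finset.sum_add_distrib]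
  refine Finset.sum_congr rfl fun j' _ => ?_
  by_cases hj : j' = j
  · subst hj; simp [serve, h]
  · simp [serve, hj]

lemma load_serve {c : Config n} {i j : Fin n} (hi : c.fetched i < c.arrived i)
    (hj : c.job j = none) (hij : i ∈ A ↔ j ∈ B) : (c.serve i j).load A B = c.load A B := by
  have h1 := waitingCount_serve (A := A) j hi
  have h2 := busyCount_serve (B := B) i hj
  unfold load
  simp only [hij] at h1
  omega

/-- The jobs of a cluster form a birth-death process. -/
lemma load_next (hC : IsCluster g A B d) {c : Config n} (hc : c.Valid g) {e : Event n} {p : Fin n}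
    (hp : (c.admissible g e).Nonempty → p ∈ c.admissible g e) (ha : c.active e ≠ none) :
    (c.next g e p).load A B = e.elim (fun i => if i ∈ A then c.load A B + 1 else c.load A B)
      fun j => if j ∈ B then c.load A B - 1 else c.load A B := by
  classical
  have hrec : (c.record e).load A B =
      e.elim (fun i => if i ∈ A then c.load A B + 1 else c.load A B)
      fun j => if j ∈ B then c.load A B - 1 else c.load A B := by
    rcases e with i | j
    · have h1 := waitingCount_arrive (A := A) (hc.fetched_le i)
      have h2 : (c.record (Sum.inl i)).busyCount B = c.busyCount B := rfl
      simp only [load, h1, h2, Sum.elim_inl]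
      split_ifs <;> omega
    · have hj : c.job j ≠ none := by simpa [active] using ha
      have h1 := busyCount_complete (B := B) hj
      have h2 : (c.record (Sum.inr j)).waitingCount A = c.waitingCount A := rfl
      simp only [load, h2, Sum.elim_inr]
      split_ifs with h
      · rw [if_pos h] at h1; omega
      · rw [if_neg h] at h1; omega
  rw [← hrec]
  unfold Config.next
  split_ifs with hA
  · have hp := hp hA
    rcases e with i | j
    · simp only [admissible, Finset.mem_filter, Finset.mem_univ, true_and] at hp
      refine load_serve ?_ hp.2 (hC.mem_iff _ _ hp.1)
      have := hc.fetched_le i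
      simp [record, servedQueue]; omega
    · simp only [admissible, Finset.mem_filter, Finset.mem_univ, true_and] at hp
      refine load_serve hp.2 ?_ (hC.mem_iff _ _ hp.1)
      simp [record, servingServer]
  · rfl

lemma busyCount_le (hC : IsCluster g A B d) (c : Config n) : c.busyCount B ≤ d := by
  classical
  unfold busyCount
  calc _ ≤ ∑ _j ∈ B, 1 := Finset.sum_le_sum fun j _ => by split_ifs <;> omega
    _ = d := by simp [hC.card]

/-- Every server of the cluster is connected to the non-empty queue, so under a greedy policy none
is idle. -/
lemma busyCount_eq_of_waiting (hC : IsCluster g A B d) {c : Config n} (hc : c.Valid g) {i : Fin n}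
    (hi : i ∈ A) (hw : c.fetched i < c.arrived i) : c.busyCount B = d := by
  classical
  unfold busyCount
  rw [← hC.card, Finset.card_eq_sum_ones]
  refine Finset.sum_congr rfl fun j hj => ?_
  rw [if_neg (hc.busy i j (hC.adj i hi j hj) hw)]

lemma lt_load_of_waiting (hC : IsCluster g A B d) {c : Config n} (hc : c.Valid g) {i : Fin n}
    (hi : i ∈ A) (hw : c.fetched i < c.arrived i) : d < c.load A B := by
  have h1 := busyCount_eq_of_waiting hC hc hi hw
  have h2 : c.arrived i - c.fetched i ≤ c.waitingCount A :=
    Finset.single_le_sum (f := fun i => c.arrived i - c.fetched i) (fun _ _ => Nat.zero_le _) hi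
  unfold load
  omega

/-- If a job waits, all `d` servers are busy and the load exceeds `d`; otherwise the load consists
of the jobs in service. Hence the death rate is a function of the load alone. -/
lemma busyCount_eq_min (hC : IsCluster g A B d) {c : Config n} (hc : c.Valid g) :
    c.busyCount B = min (c.load A B) d := by
  have h1 := busyCount_le (A := A) hC c
  by_cases hw : ∃ i ∈ A, c.fetched i < c.arrived i
  · obtain ⟨i, hi, hw⟩ := hw
    rw [busyCount_eq_of_waiting hC hc hi hw, min_eq_right (lt_load_of_waiting hC hc hi hw).le]
  · push Not at hw
    have : c.waitingCount A = 0 := Finset.sum_eq_zero fun i hi => by have := hw i hi; omega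
    simp only [load, this, zero_add]
    exact (min_eq_left h1).symm

end Config

/-- A function of the event that only depends on whether it is an arrival to a cluster, a service
completion in this cluster, or something else. -/
def clusterEvent (A B : Finset (Fin n)) {α : Type*} (P Q R : α) (e : Event n) : α :=
  e.elim (fun i => if i ∈ A then P else Q) fun j => if j ∈ B then R else Q

/-- `ρ` is the total rate of the events outside the cluster. It depends neither on `P`, `Q` nor `R`,
so it contributes equally to both sides of a drift inequality. -/
lemma sum_intensity_mul_clusterEvent (A B : Finset (Fin n)) (rate : Fin n → ℝ) (c : Config n) :
    ∃ ρ : ℝ≥0∞, ∀ P Q R : ℝ≥0∞, ∑ e, intensity rate c e * clusterEvent A B P Q R e =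
      (∑ i ∈ A, ENNReal.ofReal (rate i)) * P + c.busyCount B * R + ρ * Q := by
  classical
  refine ⟨(∑ i ∈ Aᶜ, ENNReal.ofReal (rate i)) + c.busyCount Bᶜ, fun P Q R => ?_⟩
  have hb : ∀ B : Finset (Fin n), (c.busyCount B : ℝ≥0∞) =
      ∑ j ∈ B, intensity rate c (Sum.inr j) := by
    intro B
    simp only [Config.busyCount, Nat.cast_sum]
    refine Finset.sum_congr rfl fun j _ => ?_
    by_cases h : c.job j = none <;> simp [intensity, Config.active, h, Sim.eventRate]
  rw [Fintype.sum_sum_type, ← Finset.sum_add_sum_compl A, ← Finset.sum_add_sum_compl B, hb, hb]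
  have e1 : ∑ i ∈ A, intensity rate c (Sum.inl i) * clusterEvent A B P Q R (Sum.inl i) =
      (∑ i ∈ A, ENNReal.ofReal (rate i)) * P := by
    rw [Finset.sum_mul]
    exact Finset.sum_congr rfl fun i hi => by
      simp [intensity, Config.active, Sim.eventRate, clusterEvent, hi]
  have e2 : ∑ i ∈ Aᶜ, intensity rate c (Sum.inl i) * clusterEvent A B P Q R (Sum.inl i) =
      (∑ i ∈ Aᶜ, ENNReal.ofReal (rate i)) * Q := by
    rw [Finset.sum_mul]
    exact Finset.sum_congr rfl fun i hi => by
      simp [intensity, Config.active, Sim.eventRate, clusterEvent, Finset.mem_compl.1 hi]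
  have e3 : ∑ j ∈ B, intensity rate c (Sum.inr j) * clusterEvent A B P Q R (Sum.inr j) =
      (∑ j ∈ B, intensity rate c (Sum.inr j)) * R := by
    rw [Finset.sum_mul]
    exact Finset.sum_congr rfl fun i hi => by simp [clusterEvent, hi]
  have e4 : ∑ j ∈ Bᶜ, intensity rate c (Sum.inr j) * clusterEvent A B P Q R (Sum.inr j) =
      (∑ j ∈ Bᶜ, intensity rate c (Sum.inr j)) * Q := by
    rw [Finset.sum_mul]
    exact Finset.sum_congr rfl fun i hi => by simp [clusterEvent, Finset.mem_compl.1 hi]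
  rw [e1, e2, e3, e4]
  ring

/-! ### The load along the trajectory and drift inequalities -/

variable [NeZero n] {g : Architecture n} {π : GreedyPolicy n} {rate : Fin n → ℝ}
  {A B : Finset (Fin n)} {d : ℕ}

lemma valid_cfg (hr : ∃ i, 0 < rate i) (k : ℕ) (ω : Sample n) : (cfg g π rate k ω).Valid g :=
  (inv_sim g π hr ω k).valid

lemma exists_cfg_succ_eq (k : ℕ) (ω : Sample n) :
    ∃ p, cfg g π rate (k + 1) ω = (cfg g π rate k ω).next g (event g π rate k ω) p ∧
      (((cfg g π rate k ω).admissible g (event g π rate k ω)).Nonempty →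
        p ∈ (cfg g π rate k ω).admissible g (event g π rate k ω)) :=
  ⟨_, rfl, fun h => Sim.choice_mem h⟩

lemma arrived_cfg_succ (k : ℕ) (ω : Sample n) (i : Fin n) : (cfg g π rate (k + 1) ω).arrived i =
    (cfg g π rate k ω).arrived i + if event g π rate k ω = Sum.inl i then 1 else 0 := by
  obtain ⟨p, hp, -⟩ := exists_cfg_succ_eq (g := g) (π := π) (rate := rate) k ω
  rw [hp, Config.arrived_next]

lemma fetched_cfg_le_succ (k : ℕ) (ω : Sample n) (i : Fin n) :
    (cfg g π rate k ω).fetched i ≤ (cfg g π rate (k + 1) ω).fetched i := by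
  obtain ⟨p, hp, -⟩ := exists_cfg_succ_eq (g := g) (π := π) (rate := rate) k ω
  rw [hp]
  exact Config.fetched_le_next _ _ _ _ _

lemma load_cfg_succ (hC : IsCluster g A B d) (hr : ∃ i, 0 < rate i) (k : ℕ) (ω : Sample n) :
    (cfg g π rate (k + 1) ω).load A B = clusterEvent A B ((cfg g π rate k ω).load A B + 1)
      ((cfg g π rate k ω).load A B) ((cfg g π rate k ω).load A B - 1) (event g π rate k ω) := by
  obtain ⟨p, hp, hpA⟩ := exists_cfg_succ_eq (g := g) (π := π) (rate := rate) k ω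
  rw [hp, Config.load_next hC (valid_cfg hr k ω) hpA fun h =>
    Sim.clock_ne_top hr ω (sim g π rate ω k) (Sim.clock_eq_top_of_active_eq_none h)]
  rfl

lemma measurable_comp_cfg (k : ℕ) (f : Config n → ℝ≥0∞) :
    Measurable fun ω => f (cfg g π rate k ω) :=
  (Measurable.of_discrete (f := f)).comp (measurable_cfg g π rate k)

lemma measurable_comp_cfg_event (k : ℕ) (f : Config n → Event n → ℝ≥0∞) :
    Measurable fun ω => f (cfg g π rate k ω) (event g π rate k ω) :=
  (Measurable.of_discrete (f := fun p : Config n × Event n => f p.1 p.2)).comp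
    ((measurable_cfg g π rate k).prodMk (measurable_event g π rate k))

/-- A drift inequality for a function of the load of a cluster. -/
lemma lintegral_drift (hr : ∃ i, 0 < rate i) (k : ℕ) (H α β : Config n → ℝ≥0∞)
    (P Q R : Config n → ℝ≥0∞)
    (h : ∀ c, c.Valid g → H c ≠ 0 → (∑ i ∈ A, ENNReal.ofReal (rate i)) * P c +
      c.busyCount B * R c + α c ≤
        (∑ i ∈ A, ENNReal.ofReal (rate i)) * Q c + c.busyCount B * Q c + β c) :
    ∫⁻ ω, H (cfg g π rate k ω) * clusterEvent A B (P (cfg g π rate k ω)) (Q (cfg g π rate k ω))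
        (R (cfg g π rate k ω)) (event g π rate k ω) ∂(law n) +
      ∫⁻ ω, H (cfg g π rate k ω) * α (cfg g π rate k ω) * gap g π rate k ω ∂(law n) ≤
    ∫⁻ ω, H (cfg g π rate k ω) * Q (cfg g π rate k ω) ∂(law n) +
      ∫⁻ ω, H (cfg g π rate k ω) * β (cfg g π rate k ω) * gap g π rate k ω ∂(law n) := by
  have hm : ∀ f : Config n → ℝ≥0∞,
      Measurable fun ω => f (cfg g π rate k ω) * gap g π rate k ω := fun f =>
    (measurable_comp_cfg k f).mul (measurable_gap g π rate k)
  -- Both means become time integrals, also that of `H * Q`, which does not depend on the event.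
  -- Their comparison is the bound `h` on the generator, written without subtraction.
  rw [lintegral_event hr k fun c e => H c * clusterEvent A B (P c) (Q c) (R c) e,
    lintegral_event hr k fun c _ => H c * Q c,
    ← lintegral_add_left (hm fun c => ∑ e, intensity rate c e *
      (H c * clusterEvent A B (P c) (Q c) (R c) e)),
    ← lintegral_add_left (hm fun c => ∑ e, intensity rate c e * (H c * Q c))]
  refine lintegral_mono fun ω => ?_
  have hv := valid_cfg (g := g) (π := π) hr k ω
  generalize cfg g π rate k ω = c at *
  obtain ⟨ρ, hρ⟩ := sum_intensity_mul_clusterEvent A B rate c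
  have e1 : ∑ e, intensity rate c e * (H c * clusterEvent A B (P c) (Q c) (R c) e) =
      H c * ((∑ i ∈ A, ENNReal.ofReal (rate i)) * P c + c.busyCount B * R c + ρ * Q c) := by
    rw [← hρ, Finset.mul_sum]
    exact Finset.sum_congr rfl fun e _ => by ring
  have e2 : ∑ e, intensity rate c e * (H c * Q c) =
      H c * ((∑ i ∈ A, ENNReal.ofReal (rate i)) * Q c + c.busyCount B * Q c + ρ * Q c) := by
    rw [← hρ, Finset.mul_sum]
    refine Finset.sum_congr rfl fun e _ => ?_
    have : clusterEvent A B (Q c) (Q c) (Q c) e = Q c := by rcases e with i | j <;> simp [clusterEvent]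
    rw [this]; ring
  simp only [e1, e2]
  rw [← add_mul, ← add_mul, ← mul_add, ← mul_add]
  refine mul_le_mul_left ?_ _
  by_cases hH : H c = 0
  · simp [hH]
  refine mul_le_mul_right ?_ _
  calc _ = ((∑ i ∈ A, ENNReal.ofReal (rate i)) * P c + c.busyCount B * R c + α c) + ρ * Q c := by
        ring
    _ ≤ ((∑ i ∈ A, ENNReal.ofReal (rate i)) * Q c + c.busyCount B * Q c + β c) + ρ * Q c := by
        exact add_le_add (h c hv hH) le_rfl
    _ = _ := by ring

/-- Telescoping in additive form, as in Dynkin's formula; no finiteness of the terms is needed. -/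
lemma add_sum_le_of_forall_add_le {y s t : ℕ → ℝ≥0∞} (h : ∀ k, y (k + 1) + s k ≤ y k + t k)
    (N : ℕ) : y N + ∑ k ∈ Finset.range N, s k ≤ y 0 + ∑ k ∈ Finset.range N, t k := by
  induction N with
  | zero => simp
  | succ N ih =>
    rw [Finset.sum_range_succ, Finset.sum_range_succ]
    calc _ = (y (N + 1) + s N) + ∑ k ∈ Finset.range N, s k := by ring
      _ ≤ (y N + t N) + ∑ k ∈ Finset.range N, s k := add_le_add (h N) le_rfl
      _ = (y N + ∑ k ∈ Finset.range N, s k) + t N := by ring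
      _ ≤ (y 0 + ∑ k ∈ Finset.range N, t k) + t N := by gcongr
      _ = _ := by ring

open Classical in
/-- The indicator of the configurations in which exactly `m` jobs have arrived to queue `i`. -/
def arrivedIndicator (i : Fin n) (m : ℕ) (c : Config n) : ℝ≥0∞ := if c.arrived i = m then 1 else 0

/-- The indicator of the configurations in which job `m` of queue `i` is waiting. -/
def waitingIndicator (i : Fin n) (m : ℕ) (c : Config n) : ℝ≥0∞ :=
  if m < c.arrived i ∧ c.fetched i ≤ m then 1 else 0

/-- The arrival count passes from `m` to `m + 1` at most once. -/
lemma sum_arrivedIndicator_le (i : Fin n) (m N : ℕ) (ω : Sample n) :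
    ∑ k ∈ Finset.range N, (if event g π rate k ω = Sum.inl i then
      arrivedIndicator i m (cfg g π rate k ω) else 0) ≤
      if m < (cfg g π rate N ω).arrived i then 1 else 0 := by
  induction N with
  | zero => simp
  | succ N ih =>
    rw [Finset.sum_range_succ, arrived_cfg_succ]
    refine (add_le_add_left ih _).trans ?_
    simp only [arrivedIndicator]
    split_ifs <;> first | omega | simp

lemma sum_lintegral_arrivedIndicator_le (hr : ∃ i, 0 < rate i) (i : Fin n) (m N : ℕ) :
    ENNReal.ofReal (rate i) * ∑ k ∈ Finset.range N,
      ∫⁻ ω, arrivedIndicator i m (cfg g π rate k ω) * gap g π rate k ω ∂(law n) ≤ 1 := by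
  classical
  have h : ∀ k, ENNReal.ofReal (rate i) *
      ∫⁻ ω, arrivedIndicator i m (cfg g π rate k ω) * gap g π rate k ω ∂(law n) =
      ∫⁻ ω, (if event g π rate k ω = Sum.inl i then
        arrivedIndicator i m (cfg g π rate k ω) else 0) ∂(law n) := by
    intro k
    rw [lintegral_event_eq hr, ← lintegral_const_mul' _ _ ENNReal.ofReal_ne_top]
    refine lintegral_congr fun ω => ?_
    simp [intensity, Config.active, Sim.eventRate, mul_assoc]
  rw [Finset.mul_sum]
  simp_rw [h]
  rw [← lintegral_finsetSum]
  · calc _ ≤ ∫⁻ _, 1 ∂(law n) := lintegral_mono fun ω =>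
          (sum_arrivedIndicator_le i m N ω).trans (by split_ifs <;> simp)
      _ = 1 := by simp
  · intro k _
    exact measurable_comp_cfg_event k fun c e => if e = Sum.inl i then arrivedIndicator i m c else 0

/-! ### The exponential moment of the load upon arrival -/

/-- The parameters `θ`, `a`, `κ` of a Lyapunov function for the load of a cluster. -/
structure IsLyapunov (Λ : ℝ≥0∞) (d : ℕ) (θ a κ : ℝ≥0∞) : Prop where
  one_le : 1 ≤ θ
  ne_top : θ ≠ ⊤
  pos : a ≠ 0
  a_ne_top : a ≠ ⊤
  one_le_bound : 1 ≤ κ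
  -- For `x = 0` the truncated exponent `x - 1` is harmless, since its coefficient vanishes.
  drift : ∀ x : ℕ, Λ * θ ^ (x + 1) + (min x d : ℕ) * θ ^ (x - 1) + a * θ ^ x ≤
    Λ * θ ^ x + (min x d : ℕ) * θ ^ x + a * κ

variable {θ a κ : ℝ≥0∞}

/-- The exponential moment of the load of a cluster that is found by a job upon arrival. -/
lemma sum_lintegral_pow_load_le (hC : IsCluster g A B d)
    (hL : IsLyapunov (∑ i ∈ A, ENNReal.ofReal (rate i)) d θ a κ) {i : Fin n} (hi : i ∈ A)
    (hri : 0 < rate i) (m N : ℕ) :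
    ENNReal.ofReal (rate i) * ∑ k ∈ Finset.range N,
      ∫⁻ ω, arrivedIndicator i m (cfg g π rate k ω) * θ ^ ((cfg g π rate k ω).load A B) *
        gap g π rate k ω ∂(law n) ≤ κ := by
  classical
  have hr : ∃ i, 0 < rate i := ⟨i, hri⟩
  set r := ENNReal.ofReal (rate i) with hrdef
  have hrt : r ≠ ⊤ := ENNReal.ofReal_ne_top
  set D : (ℕ → ℝ≥0∞) → ℕ → ℝ≥0∞ := fun f k =>
    ∫⁻ ω, f ((cfg g π rate k ω).arrived i) * θ ^ ((cfg g π rate k ω).load A B) *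
      gap g π rate k ω ∂(law n) with hD
  have hevent : ∀ f k, ∫⁻ ω, f ((cfg g π rate k ω).arrived i) *
      (if event g π rate k ω = Sum.inl i then
        θ * θ ^ ((cfg g π rate k ω).load A B) else 0) ∂(law n) = θ * (r * D f k) := by
    intro f k
    have h1 : ∀ ω, f ((cfg g π rate k ω).arrived i) * (if event g π rate k ω = Sum.inl i then
        θ * θ ^ ((cfg g π rate k ω).load A B) else 0) =
        if event g π rate k ω = Sum.inl i then (fun c : Config n =>
        f (c.arrived i) * (θ * θ ^ (c.load A B))) (cfg g π rate k ω) else 0 := by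
      intro ω; split_ifs <;> simp
    simp_rw [h1]
    refine (lintegral_event_eq hr k (Sum.inl i)
      fun c => f (c.arrived i) * (θ * θ ^ (c.load A B))).trans ?_
    rw [hD, ← lintegral_const_mul' _ _ hrt, ← lintegral_const_mul' _ _ hL.ne_top]
    refine lintegral_congr fun ω => ?_
    simp [intensity, Config.active, Sim.eventRate, ← hrdef]
    ring
  set J : ℕ → ℕ → ℝ≥0∞ := fun m x => if x = m then 1 else 0 with hJ
  set Jp : ℕ → ℕ → ℝ≥0∞ := fun m x => if x + 1 = m then 1 else 0 with hJp
  -- The balance of `θ ^ load` over the period in which the arrival count of queue `i` is `m`: mass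
  -- enters from the period of `m - 1` and leaves at the next arrival, each time at rate `r` and
  -- with a factor `θ` for the arriving job.
  have hrec : ∀ m N, (θ * r + a) * ∑ k ∈ Finset.range N, D (J m) k ≤
      J m 0 + θ * r * (∑ k ∈ Finset.range N, D (Jp m) k) + a * κ * ∑ k ∈ Finset.range N,
        ∫⁻ ω, arrivedIndicator i m (cfg g π rate k ω) * gap g π rate k ω ∂(law n) := by
    intro m N
    have hstep : ∀ k, (∫⁻ ω, J m ((cfg g π rate (k + 1) ω).arrived i) *
          θ ^ ((cfg g π rate (k + 1) ω).load A B) ∂(law n)) + (θ * r + a) * D (J m) k ≤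
        (∫⁻ ω, J m ((cfg g π rate k ω).arrived i) *
          θ ^ ((cfg g π rate k ω).load A B) ∂(law n)) + (θ * r * D (Jp m) k + a * κ *
          ∫⁻ ω, arrivedIndicator i m (cfg g π rate k ω) * gap g π rate k ω ∂(law n)) := by
      intro k
      have h1 := lintegral_drift (g := g) (π := π) (A := A) (B := B) hr k
        (H := fun c => J m (c.arrived i)) (α := fun c => a * θ ^ (c.load A B))
        (β := fun _ => a * κ) (P := fun c => θ ^ (c.load A B + 1)) (Q := fun c => θ ^ (c.load A B))
        (R := fun c => θ ^ (c.load A B - 1))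
        (fun c hc _ => by
          have := hL.drift (c.load A B)
          rwa [← Config.busyCount_eq_min hC hc] at this)
      -- The drift inequality freezes the indicator of the count. Replacing it by its value after
      -- the event costs the mass leaving count `m` and gains the mass coming from `m - 1`.
      have h2 : ∫⁻ ω, J m ((cfg g π rate (k + 1) ω).arrived i) *
          θ ^ ((cfg g π rate (k + 1) ω).load A B) ∂(law n) + θ * (r * D (J m) k) =
          ∫⁻ ω, J m ((cfg g π rate k ω).arrived i) * clusterEvent A B
            (θ ^ ((cfg g π rate k ω).load A B + 1)) (θ ^ ((cfg g π rate k ω).load A B))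
            (θ ^ ((cfg g π rate k ω).load A B - 1)) (event g π rate k ω) ∂(law n) +
          θ * (r * D (Jp m) k) := by
        rw [← hevent, ← hevent, ← lintegral_add_left, ← lintegral_add_left]
        · refine lintegral_congr fun ω => ?_
          rw [load_cfg_succ hC hr, arrived_cfg_succ]
          by_cases he : event g π rate k ω = Sum.inl i
          · simp only [he, if_true, clusterEvent, Sum.elim_inl, hi, hJ, hJp]
            rw [pow_succ']
            ring
          · simp only [he, if_false, add_zero, mul_zero]
            congr 1
            rcases event g π rate k ω with i' | j <;> simp only [clusterEvent, Sum.elim_inl,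
              Sum.elim_inr] <;> split_ifs <;> rfl
        · exact measurable_comp_cfg_event k fun c e => J m (c.arrived i) * clusterEvent A B
            (θ ^ (c.load A B + 1)) (θ ^ (c.load A B)) (θ ^ (c.load A B - 1)) e
        · exact measurable_comp_cfg (k + 1) fun c => J m (c.arrived i) * θ ^ (c.load A B)
      have h3 : ∫⁻ ω, J m ((cfg g π rate k ω).arrived i) * (a * θ ^ ((cfg g π rate k ω).load A B)) *
          gap g π rate k ω ∂(law n) = a * D (J m) k := by
        rw [hD, ← lintegral_const_mul' _ _ hL.a_ne_top]
        exact lintegral_congr fun ω => by ring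
      have h4 : ∫⁻ ω, J m ((cfg g π rate k ω).arrived i) * (a * κ) * gap g π rate k ω ∂(law n) ≤
          a * κ * ∫⁻ ω, arrivedIndicator i m (cfg g π rate k ω) * gap g π rate k ω ∂(law n) := by
        have hm : Measurable fun ω =>
            arrivedIndicator i m (cfg g π rate k ω) * gap g π rate k ω :=
          (measurable_comp_cfg k _).mul (measurable_gap g π rate k)
        rw [← lintegral_const_mul _ hm]
        refine (lintegral_congr fun ω => ?_).le
        simp only [hJ, arrivedIndicator]
        ring
      calc _ = (∫⁻ ω, J m ((cfg g π rate (k + 1) ω).arrived i) *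
          θ ^ ((cfg g π rate (k + 1) ω).load A B) ∂(law n) + θ * (r * D (J m) k)) +
            a * D (J m) k := by ring
        _ = _ := by rw [h2]
        _ = (∫⁻ ω, J m ((cfg g π rate k ω).arrived i) * clusterEvent A B
            (θ ^ ((cfg g π rate k ω).load A B + 1)) (θ ^ ((cfg g π rate k ω).load A B))
            (θ ^ ((cfg g π rate k ω).load A B - 1)) (event g π rate k ω) ∂(law n) +
            a * D (J m) k) + θ * (r * D (Jp m) k) := by ring
        _ ≤ _ := by
          rw [← h3]
          refine (add_le_add_left h1 _).trans ?_
          rw [add_assoc, add_comm (lintegral _ _) (θ * (r * D (Jp m) k)), ← mul_assoc θ r]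
          gcongr
    have h := add_sum_le_of_forall_add_le hstep N
    rw [← Finset.mul_sum, Finset.sum_add_distrib, ← Finset.mul_sum, ← Finset.mul_sum] at h
    refine (le_add_self.trans h).trans ?_
    rw [← add_assoc]
    gcongr
    have hload : (Config.init n).load A B = 0 := by
      simp [Config.load, Config.waitingCount, Config.busyCount, Config.init]
    have : ∀ ω, cfg g π rate 0 ω = Config.init n := fun ω => rfl
    simp only [this, hload, pow_zero, mul_one, lintegral_const, measure_univ]
    exact le_rfl
  have hfin : θ * r + a ≠ ⊤ := ENNReal.add_ne_top.2 ⟨ENNReal.mul_ne_top hL.ne_top hrt, hL.a_ne_top⟩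
  have hpos : θ * r + a ≠ 0 := by simp [hL.pos]
  -- Write `z m` for the left side. Multiplying `hrec` by `r` gives `(θ * r + a) * z (m + 1) ≤ θ * r
  -- * z m + a * κ`, so the bound `κ` propagates. For `m = 0` the empty initial state contributes
  -- `r`, which is at most `θ * r * κ`.
  suffices hmain : ∀ m, r * ∑ k ∈ Finset.range N, D (J m) k ≤ κ from hmain m
  intro m
  induction m with
  | zero =>
    have h := hrec 0 N
    have h0 : ∀ k, D (Jp 0) k = 0 := fun k => by simp [hD, hJp]
    have hz := sum_lintegral_arrivedIndicator_le (g := g) (π := π) hr i 0 N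
    simp only [h0, Finset.sum_const_zero, mul_zero, add_zero] at h
    rw [← ENNReal.mul_le_mul_iff_right hpos hfin]
    calc _ = r * ((θ * r + a) * ∑ k ∈ Finset.range N, D (J 0) k) := by ring
      _ ≤ r * (J 0 0 + a * κ * ∑ k ∈ Finset.range N,
        ∫⁻ ω, arrivedIndicator i 0 (cfg g π rate k ω) * gap g π rate k ω ∂(law n)) := by gcongr
      _ = r + a * κ * (r * ∑ k ∈ Finset.range N,
        ∫⁻ ω, arrivedIndicator i 0 (cfg g π rate k ω) * gap g π rate k ω ∂(law n)) := by
          simp only [hJ, if_true]; ring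
      _ ≤ 1 * r * 1 + a * κ * 1 := by rw [one_mul, mul_one]; gcongr
      _ ≤ θ * r * κ + a * κ * 1 := by
          gcongr
          · exact hL.one_le
          · exact hL.one_le_bound
      _ = _ := by ring
  | succ m ih =>
    have h := hrec (m + 1) N
    have h0 : Jp (m + 1) = J m := by
      funext x; simp [hJ, hJp]
    have hz := sum_lintegral_arrivedIndicator_le (g := g) (π := π) hr i (m + 1) N
    have hJ0 : J (m + 1) 0 = 0 := by simp [hJ]
    rw [h0, hJ0, zero_add] at h
    rw [← ENNReal.mul_le_mul_iff_right hpos hfin]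
    calc _ = r * ((θ * r + a) * ∑ k ∈ Finset.range N, D (J (m + 1)) k) := by ring
      _ ≤ r * (θ * r * (∑ k ∈ Finset.range N, D (J m) k) + a * κ * ∑ k ∈ Finset.range N,
        ∫⁻ ω, arrivedIndicator i (m + 1) (cfg g π rate k ω) * gap g π rate k ω ∂(law n)) := by
          gcongr
      _ = θ * r * (r * ∑ k ∈ Finset.range N, D (J m) k) + a * κ * (r * ∑ k ∈ Finset.range N,
        ∫⁻ ω, arrivedIndicator i (m + 1) (cfg g π rate k ω) * gap g π rate k ω ∂(law n)) := by ring
      _ ≤ θ * r * κ + a * κ * 1 := by gcongr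
      _ = _ := by ring

end Flex

end

noncomputable section

namespace Flex

variable {n : ℕ} [NeZero n] {g : Architecture n} {π : GreedyPolicy n} {rate : Fin n → ℝ}
  {A B : Finset (Fin n)} {d : ℕ} {θ a κ : ℝ≥0∞}

/-! ### Waiting times -/

/-- A job waiting after the event either was waiting before it, or has just arrived and counts
itself in the load. A fetch of the job only drops a nonnegative term, so an inequality suffices and
the order of service is immaterial. -/
lemma waitingIndicator_mul_load_le (hC : IsCluster g A B d) (hr : ∃ i, 0 < rate i) {i : Fin n}
    (hi : i ∈ A) (m k : ℕ) (ω : Sample n) :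
    waitingIndicator i m (cfg g π rate (k + 1) ω) *
      (((cfg g π rate (k + 1) ω).load A B - d : ℕ) : ℝ≥0∞) ≤
    waitingIndicator i m (cfg g π rate k ω) * clusterEvent A B
      (((cfg g π rate k ω).load A B + 1 - d : ℕ) : ℝ≥0∞)
      (((cfg g π rate k ω).load A B - d : ℕ) : ℝ≥0∞)
      (((cfg g π rate k ω).load A B - 1 - d : ℕ) : ℝ≥0∞) (event g π rate k ω) +
    (if event g π rate k ω = Sum.inl i then arrivedIndicator i m (cfg g π rate k ω) *
      (((cfg g π rate k ω).load A B + 1 - d : ℕ) : ℝ≥0∞) else 0) := by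
  by_cases hw : m < (cfg g π rate (k + 1) ω).arrived i ∧ (cfg g π rate (k + 1) ω).fetched i ≤ m
  swap
  · simp [waitingIndicator, hw]
  have hf := (fetched_cfg_le_succ (g := g) (π := π) (rate := rate) k ω i).trans hw.2
  have ha := hw.1
  rw [arrived_cfg_succ] at ha
  have h1 : waitingIndicator i m (cfg g π rate (k + 1) ω) = 1 := if_pos hw
  rw [h1, one_mul, load_cfg_succ hC hr]
  by_cases hm : m < (cfg g π rate k ω).arrived i
  · have h2 : waitingIndicator i m (cfg g π rate k ω) = 1 := if_pos ⟨hm, hf⟩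
    rw [h2, one_mul]
    refine le_add_right (le_of_eq ?_)
    rcases event g π rate k ω with i' | j <;> simp only [clusterEvent, Sum.elim_inl,
      Sum.elim_inr] <;> split_ifs <;> rfl
  · split_ifs at ha with he
    · have hm' : (cfg g π rate k ω).arrived i = m := by omega
      refine le_add_left (le_of_eq ?_)
      rw [if_pos he]
      simp [he, clusterEvent, hi, arrivedIndicator, hm']
    · omega

/-- The expected time that a job spends waiting. -/
lemma sum_lintegral_waiting_le (hC : IsCluster g A B d)
    (hL : IsLyapunov (∑ i ∈ A, ENNReal.ofReal (rate i)) d θ a κ) {δ C : ℝ≥0∞}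
    (hδ : (∑ i ∈ A, ENNReal.ofReal (rate i)) + δ ≤ d)
    (hCθ : ∀ x : ℕ, ((x + 1 - d : ℕ) : ℝ≥0∞) ≤ C * θ ^ x)
    {i : Fin n} (hi : i ∈ A) (hri : 0 < rate i) (m N : ℕ) :
    δ * ∑ k ∈ Finset.range N,
      ∫⁻ ω, waitingIndicator i m (cfg g π rate k ω) * gap g π rate k ω ∂(law n) ≤ C * κ := by
  classical
  have hr : ∃ i, 0 < rate i := ⟨i, hri⟩
  have hmw : ∀ k, Measurable fun ω =>
      waitingIndicator i m (cfg g π rate k ω) * gap g π rate k ω := fun k =>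
    (measurable_comp_cfg k _).mul (measurable_gap g π rate k)
  have hmD : ∀ k, Measurable fun ω => arrivedIndicator i m (cfg g π rate k ω) *
      θ ^ ((cfg g π rate k ω).load A B) * gap g π rate k ω := fun k =>
    (measurable_comp_cfg k fun c => arrivedIndicator i m c * θ ^ (c.load A B)).mul
      (measurable_gap g π rate k)
  have hstep : ∀ k, (∫⁻ ω, waitingIndicator i m (cfg g π rate (k + 1) ω) *
      (((cfg g π rate (k + 1) ω).load A B - d : ℕ) : ℝ≥0∞) ∂(law n)) +
      δ * ∫⁻ ω, waitingIndicator i m (cfg g π rate k ω) * gap g π rate k ω ∂(law n) ≤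
      (∫⁻ ω, waitingIndicator i m (cfg g π rate k ω) *
      (((cfg g π rate k ω).load A B - d : ℕ) : ℝ≥0∞) ∂(law n)) +
      C * (ENNReal.ofReal (rate i) * ∫⁻ ω, arrivedIndicator i m (cfg g π rate k ω) *
        θ ^ ((cfg g π rate k ω).load A B) * gap g π rate k ω ∂(law n)) := by
    intro k
    have h1 := lintegral_drift (g := g) (π := π) (A := A) (B := B) hr k
      (H := waitingIndicator i m) (α := fun _ => δ) (β := fun _ => 0)
      (P := fun c => ((c.load A B + 1 - d : ℕ) : ℝ≥0∞)) (Q := fun c => ((c.load A B - d : ℕ) : ℝ≥0∞))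
      (R := fun c => ((c.load A B - 1 - d : ℕ) : ℝ≥0∞))
      (fun c hc hH => by
        have hw : c.fetched i < c.arrived i := by
          by_contra h
          exact hH (if_neg fun h' => by omega)
        rw [Config.busyCount_eq_of_waiting hC hc hi hw]
        -- While the job waits, the load is `d + u + 1`, so that the truncated subtractions are
        -- exact, and the drift inequality reduces to `Λ + δ ≤ d`, where `Λ` is the total rate of
        -- `A`.
        obtain ⟨u, hu⟩ := Nat.exists_eq_add_of_lt (Config.lt_load_of_waiting hC hc hi hw)
        rw [show c.load A B + 1 - d = u + 2 by omega, show c.load A B - d = u + 1 by omega,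
          show c.load A B - 1 - d = u by omega]
        push_cast
        calc _ = ((∑ i ∈ A, ENNReal.ofReal (rate i)) + δ) + d * u +
              (∑ i ∈ A, ENNReal.ofReal (rate i)) * (u + 1) := by ring
          _ ≤ d + d * u + (∑ i ∈ A, ENNReal.ofReal (rate i)) * (u + 1) := by gcongr
          _ = _ := by ring)
    have h2 := lintegral_mono (μ := law n) fun ω =>
      waitingIndicator_mul_load_le (g := g) (π := π) hC hr hi m k ω
    rw [lintegral_add_left (measurable_comp_cfg_event k fun c e => waitingIndicator i m c *
      clusterEvent A B ((c.load A B + 1 - d : ℕ) : ℝ≥0∞) ((c.load A B - d : ℕ) : ℝ≥0∞)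
        ((c.load A B - 1 - d : ℕ) : ℝ≥0∞) e),
      lintegral_event_eq hr k (Sum.inl i) fun c => arrivedIndicator i m c *
        ((c.load A B + 1 - d : ℕ) : ℝ≥0∞)] at h2
    have h3 : ∫⁻ ω, waitingIndicator i m (cfg g π rate k ω) * δ * gap g π rate k ω ∂(law n) =
        δ * ∫⁻ ω, waitingIndicator i m (cfg g π rate k ω) * gap g π rate k ω ∂(law n) := by
      rw [← lintegral_const_mul _ (hmw k)]
      exact lintegral_congr fun ω => by ring
    have h4 : ∫⁻ ω, intensity rate (cfg g π rate k ω) (Sum.inl i) *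
        (arrivedIndicator i m (cfg g π rate k ω) *
          (((cfg g π rate k ω).load A B + 1 - d : ℕ) : ℝ≥0∞)) * gap g π rate k ω ∂(law n) ≤
        C * (ENNReal.ofReal (rate i) * ∫⁻ ω, arrivedIndicator i m (cfg g π rate k ω) *
          θ ^ ((cfg g π rate k ω).load A B) * gap g π rate k ω ∂(law n)) := by
      rw [← mul_assoc, ← lintegral_const_mul _ (hmD k)]
      refine lintegral_mono fun ω => ?_
      have : intensity rate (cfg g π rate k ω) (Sum.inl i) = ENNReal.ofReal (rate i) := by
        simp [intensity, Config.active, Sim.eventRate]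
      simp only [this]
      calc _ ≤ ENNReal.ofReal (rate i) * (arrivedIndicator i m (cfg g π rate k ω) *
          (C * θ ^ ((cfg g π rate k ω).load A B))) * gap g π rate k ω := by gcongr; exact hCθ _
        _ = _ := by ring
    simp only [mul_zero, zero_mul, lintegral_zero, add_zero] at h1
    rw [h3] at h1
    calc _ ≤ _ := add_le_add h2 le_rfl
      _ = _ := by rw [add_right_comm]
      _ ≤ _ := add_le_add h1 h4
  have h := add_sum_le_of_forall_add_le hstep N
  rw [← Finset.mul_sum, ← Finset.mul_sum, ← Finset.mul_sum] at h
  refine (le_add_self.trans h).trans ?_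
  have h0 : ∀ ω, waitingIndicator i m (cfg g π rate 0 ω) = 0 := fun ω =>
    if_neg fun h => Nat.not_lt_zero m h.1
  simp only [h0, zero_mul, lintegral_zero, zero_add]
  gcongr
  exact sum_lintegral_pow_load_le hC hL hi hri m N

/-! ### From expected durations to waiting times -/

/-- The total rate at which events happen is bounded. -/
lemma lintegral_le_lintegral_mul_gap (hr : ∃ i, 0 < rate i) (k : ℕ) (H : Config n → ℝ≥0∞) :
    ∫⁻ ω, H (cfg g π rate k ω) ∂(law n) ≤ (∑ e, ENNReal.ofReal (Sim.eventRate rate e)) *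
      ∫⁻ ω, H (cfg g π rate k ω) * gap g π rate k ω ∂(law n) := by
  rw [lintegral_event hr k fun c _ => H c, ← lintegral_const_mul' _ _
    (ENNReal.sum_ne_top.2 fun _ _ => ENNReal.ofReal_ne_top)]
  refine lintegral_mono fun ω => ?_
  simp only [← Finset.sum_mul]
  rw [mul_assoc]
  refine mul_le_mul_left (Finset.sum_le_sum fun e _ => ?_) _
  unfold intensity
  split_ifs <;> simp

/-- A configuration in which the system spends a finite expected time is visited finitely often. -/
lemma ae_eventually_eq_zero (hr : ∃ i, 0 < rate i) {H : Config n → ℝ≥0∞}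
    (hH : ∀ c, H c = 0 ∨ H c = 1) {M : ℝ≥0∞} (hM : M ≠ ⊤)
    (h : ∀ N, ∑ k ∈ Finset.range N,
      ∫⁻ ω, H (cfg g π rate k ω) * gap g π rate k ω ∂(law n) ≤ M) :
    ∀ᵐ ω ∂(law n), ∀ᶠ k in atTop, H (cfg g π rate k ω) = 0 := by
  have hR : (∑ e, ENNReal.ofReal (Sim.eventRate rate e)) ≠ ⊤ :=
    ENNReal.sum_ne_top.2 fun _ _ => ENNReal.ofReal_ne_top
  have hfin : ∫⁻ ω, ∑' k, H (cfg g π rate k ω) ∂(law n) ≠ ⊤ := by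
    rw [lintegral_tsum fun k => (measurable_comp_cfg k H).aemeasurable]
    refine ne_top_of_le_ne_top (ENNReal.mul_ne_top hR hM)
      (ENNReal.tsum_le_of_sum_range_le fun N => ?_)
    calc _ ≤ _ := Finset.sum_le_sum fun k _ => lintegral_le_lintegral_mul_gap hr k H
      _ = _ := by rw [← Finset.mul_sum]
      _ ≤ _ := by gcongr; exact h N
  filter_upwards [ae_lt_top (Measurable.tsum fun k => measurable_comp_cfg k H) hfin]
    with ω hω
  have := ENNReal.tendsto_atTop_zero_of_tsum_ne_top hω.ne
  filter_upwards [this.eventually_lt_const one_pos] with k hk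
  rcases hH (cfg g π rate k ω) with h | h
  · exact h
  · exact absurd hk (by simp [h])

/-- Each value `m' ≤ m` of the count lasts for a mean time of at most `1 / rate i`, hence is almost
surely seen at finitely many events only. -/
lemma ae_eventually_lt_arrived {i : Fin n} (hri : 0 < rate i) (m : ℕ) :
    ∀ᵐ ω ∂(law n), ∀ᶠ k in atTop, m < (cfg g π rate k ω).arrived i := by
  have h : ∀ᵐ ω ∂(law n), ∀ m' ≤ m, ∀ᶠ k in atTop,
      arrivedIndicator i m' (cfg g π rate k ω) = 0 := by
    refine ae_all_iff.2 fun m' => ?_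
    have h0 : ENNReal.ofReal (rate i) ≠ 0 := by simpa using hri
    refine (ae_eventually_eq_zero (g := g) (π := π) ⟨i, hri⟩ (H := arrivedIndicator i m')
      (M := 1 / ENNReal.ofReal (rate i)) ?_ ?_ fun N => ?_).mono fun ω hω _ => hω
    · intro c; unfold arrivedIndicator; split_ifs <;> simp
    · exact ENNReal.div_ne_top ENNReal.one_ne_top h0
    · rw [ENNReal.le_div_iff_mul_le (Or.inl h0) (Or.inl ENNReal.ofReal_ne_top), mul_comm]
      exact sum_lintegral_arrivedIndicator_le ⟨i, hri⟩ i m' N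
  filter_upwards [h] with ω hω
  have : ∀ᶠ k in atTop, ∀ m' ∈ Finset.range (m + 1),
      arrivedIndicator i m' (cfg g π rate k ω) = 0 := by
    rw [Filter.eventually_all_finset]
    exact fun m' hm' => hω m' (Nat.lt_succ_iff.1 (Finset.mem_range.1 hm'))
  filter_upwards [this] with k hk
  by_contra hlt
  have := hk _ (Finset.mem_range.2 (Nat.lt_succ_iff.2 (not_lt.1 hlt)))
  simp [arrivedIndicator] at this

/-- Time runs from the arrival of the job through consecutive gaps, during all of which the job is
waiting. The event at which the count passes `m` is the arrival itself. -/
lemma time_le_of_waiting {i : Fin n} {m k : ℕ} {ω : Sample n}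
    (h : ∀ l < k, (cfg g π rate l ω).fetched i ≤ m) (hk : m < (cfg g π rate k ω).arrived i) :
    (sim g π rate ω k).time ≤ arrivalTime rate ω i m +
      ∑ l ∈ Finset.range k, waitingIndicator i m (cfg g π rate l ω) * gap g π rate l ω := by
  induction k with
  | zero => exact absurd hk (Nat.not_lt_zero m)
  | succ k ih =>
    have htime : (sim g π rate ω (k + 1)).time =
        (sim g π rate ω k).clock rate ω (event g π rate k ω) := rfl
    by_cases hm : m < (cfg g π rate k ω).arrived i
    · have hw : waitingIndicator i m (cfg g π rate k ω) = 1 := if_pos ⟨hm, h k k.lt_succ_self⟩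
      rw [Finset.sum_range_succ, hw, one_mul, ← add_assoc, htime]
      refine le_add_tsub.trans (add_le_add (ih (fun l hl => h l (by omega)) hm) le_rfl)
    · rw [arrived_cfg_succ] at hk
      split_ifs at hk with he
      · have : (cfg g π rate k ω).arrived i = m := by omega
        rw [htime, he]
        refine le_add_right (le_of_eq ?_)
        rw [← this]
        rfl
      · omega

/-- The expected waiting time of every job. -/
lemma lintegral_waitingTime_le (hC : IsCluster g A B d)
    (hL : IsLyapunov (∑ i ∈ A, ENNReal.ofReal (rate i)) d θ a κ) {δ C : ℝ≥0∞}
    (hδ : (∑ i ∈ A, ENNReal.ofReal (rate i)) + δ ≤ d) (hδ0 : δ ≠ 0)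
    (hCθ : ∀ x : ℕ, ((x + 1 - d : ℕ) : ℝ≥0∞) ≤ C * θ ^ x) (hCκ : C * κ ≠ ⊤)
    {i : Fin n} (hi : i ∈ A) (hri : 0 < rate i) (m : ℕ) :
    ∫⁻ ω, waitingTime g π rate ω i m ∂(law n) ≤ C * κ / δ := by
  have hr : ∃ i, 0 < rate i := ⟨i, hri⟩
  have hδt : δ ≠ ⊤ := ne_top_of_le_ne_top (ENNReal.natCast_ne_top d) (le_add_self.trans hδ)
  have hsum : ∀ N, ∑ k ∈ Finset.range N,
      ∫⁻ ω, waitingIndicator i m (cfg g π rate k ω) * gap g π rate k ω ∂(law n) ≤ C * κ / δ := by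
    intro N
    rw [ENNReal.le_div_iff_mul_le (Or.inl hδ0) (Or.inl hδt), mul_comm]
    exact sum_lintegral_waiting_le hC hL hδ hCθ hi hri m N
  have hfetch : ∀ᵐ ω ∂(law n), ∀ᶠ k in atTop, waitingIndicator i m (cfg g π rate k ω) = 0 :=
    ae_eventually_eq_zero hr (fun c => by unfold waitingIndicator; split_ifs <;> simp)
      (ENNReal.div_ne_top hCκ hδ0) hsum
  calc ∫⁻ ω, waitingTime g π rate ω i m ∂(law n)
      ≤ ∫⁻ ω, ∑' k, waitingIndicator i m (cfg g π rate k ω) * gap g π rate k ω ∂(law n) := by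
        refine lintegral_mono_ae ?_
        filter_upwards [ae_run_eq g π hr, hfetch, ae_eventually_lt_arrived (g := g) (π := π) hri m]
          with ω hrun hf ha
        -- At some event the job has arrived and is no longer waiting, so it has been fetched. The
        -- first such index `K` bounds the infimum that defines `startTime`.
        obtain ⟨k₀, hk₀, hk₀'⟩ := (hf.and ha).exists
        have hex : ∃ k, m < (cfg g π rate k ω).fetched i := by
          refine ⟨k₀, ?_⟩
          by_contra h
          simp [waitingIndicator, hk₀', not_lt.1 h] at hk₀
        classical
        have hK := Nat.find_spec hex
        have hKmin : ∀ l < Nat.find hex, (cfg g π rate l ω).fetched i ≤ m := fun l hl =>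
          not_lt.1 (Nat.find_min hex hl)
        generalize Nat.find hex = K at hK hKmin
        have hstart : startTime g π rate ω i m ≤ (sim g π rate ω K).time := by
          refine (iInf_le _ K).trans ?_
          have hK' : m < ((sim g π rate ω K).toState ω).fetched i := hK
          rw [hrun K, if_pos hK']
          exact le_rfl
        have htime := time_le_of_waiting hKmin
          (hK.trans_le ((valid_cfg hr K ω).fetched_le i))
        refine tsub_le_iff_left.2 ((hstart.trans htime).trans ?_)
        gcongr
        exact ENNReal.sum_le_tsum _
    _ = ∑' k, ∫⁻ ω, waitingIndicator i m (cfg g π rate k ω) * gap g π rate k ω ∂(law n) :=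
        lintegral_tsum fun k => ((measurable_comp_cfg k _).mul
          (measurable_gap g π rate k)).aemeasurable
    _ ≤ C * κ / δ := ENNReal.tsum_le_of_sum_range_le hsum

end Flex

end

noncomputable section

namespace Flex

/-! ### Modular architectures -/

/-- A cluster size `0` would leave no index for queue `0`, as `n / 0 = 0`. Since `σ i < n / d`, the
whole block of `d` servers with index `σ i` fits below `n`. -/
lemma IsModular.exists_isCluster {n d : ℕ} [NeZero n] {g : Architecture n} (hg : IsModular d g) :
    0 < d ∧ ∀ i, ∃ A B, IsCluster g A B d ∧ i ∈ A := by
  obtain ⟨σ, -, hσ⟩ := hg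
  have hd : 0 < d := by
    rcases Nat.eq_zero_or_pos d with rfl | h
    · have := (σ 0).2
      simp at this
    · exact h
  refine ⟨hd, fun i => ⟨Finset.univ.filter fun i' => σ i' = σ i,
    Finset.univ.filter fun j : Fin n => (j : ℕ) / d = σ i, ⟨?_, ?_, ?_⟩, by simp⟩⟩
  · intro i' j hij
    rw [hσ] at hij
    simp only [Finset.mem_filter, Finset.mem_univ, true_and, ← hij]
    exact Fin.ext_iff
  · intro i' hi' j hj
    simp only [Finset.mem_filter, Finset.mem_univ, true_and] at hi' hj
    rw [hσ, hi', hj]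
  · have hle : d * σ i + d ≤ n := by
      have h1 : (σ i : ℕ) + 1 ≤ n / d := (σ i).2
      calc d * (σ i : ℕ) + d = d * ((σ i : ℕ) + 1) := by ring
        _ ≤ d * (n / d) := Nat.mul_le_mul_left d h1
        _ ≤ n := Nat.mul_div_le n d
    have : (Finset.univ.filter fun j : Fin n => (j : ℕ) / d = σ i).map Fin.valEmbedding =
        Finset.Ico (d * σ i) (d * σ i + d) := by
      ext x
      simp only [Finset.mem_map, Finset.mem_filter, Finset.mem_univ, true_and,
        Fin.valEmbedding_apply, Finset.mem_Ico]
      have hx : x / d = σ i ↔ d * σ i ≤ x ∧ x < d * σ i + d := by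
        rw [Nat.div_eq_iff hd, mul_comm]
        omega
      constructor
      · rintro ⟨j, hj, rfl⟩
        exact hx.1 hj
      · intro h
        exact ⟨⟨x, by omega⟩, hx.2 h, rfl⟩
    rw [← Finset.card_map Fin.valEmbedding, this]
    simp

lemma nonneg_of_mem_smul_capacityRegion {n : ℕ} {g : Architecture n} {γ : ℝ} (hγ : 0 ≤ γ)
    {rate : Fin n → ℝ} (h : rate ∈ γ • capacityRegion g) (i : Fin n) : 0 ≤ rate i := by
  obtain ⟨x, ⟨f, hf, -, hf0⟩, rfl⟩ := h
  simp only [Pi.smul_apply, smul_eq_mul, hf]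
  refine mul_nonneg hγ (Finset.sum_nonneg fun j hj => hf0 i j ?_)
  simpa using hj

/-- All flow out of `A` ends in `B`, whose `d` servers absorb at most `1` each. -/
lemma IsCluster.sum_rate_le {n d : ℕ} {g : Architecture n} {A B : Finset (Fin n)}
    (hC : IsCluster g A B d) {γ : ℝ} (hγ : 0 ≤ γ) {rate : Fin n → ℝ}
    (h : rate ∈ γ • capacityRegion g) : ∑ i ∈ A, rate i ≤ γ * d := by
  obtain ⟨x, ⟨f, hf, hf1, hf0⟩, rfl⟩ := h
  have h1 : ∀ i ∈ A, (Finset.univ.filter fun j => (i, j) ∈ g) = B := by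
    intro i hi
    ext j
    simp only [Finset.mem_filter, Finset.mem_univ, true_and]
    exact ⟨fun hij => (hC.mem_iff i j hij).1 hi, fun hj => hC.adj i hi j hj⟩
  have h2 : ∀ j ∈ B, (Finset.univ.filter fun i => (i, j) ∈ g) = A := by
    intro j hj
    ext i
    simp only [Finset.mem_filter, Finset.mem_univ, true_and]
    exact ⟨fun hij => (hC.mem_iff i j hij).2 hj, fun hi => hC.adj i hi j hj⟩
  simp only [Pi.smul_apply, smul_eq_mul]
  rw [← Finset.mul_sum]
  refine mul_le_mul_of_nonneg_left ?_ hγ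
  calc ∑ i ∈ A, x i = ∑ i ∈ A, ∑ j ∈ B, f i j :=
        Finset.sum_congr rfl fun i hi => by rw [hf, h1 i hi]
    _ = ∑ j ∈ B, ∑ i ∈ A, f i j := Finset.sum_comm
    _ ≤ ∑ _j ∈ B, (1 : ℝ) := Finset.sum_le_sum fun j hj => by
        have := (hf1 j).le
        rwa [h2 j hj] at this
    _ = d := by simp [hC.card]

/-! ### Choice of the Lyapunov parameters -/

/-- The drift of `θ ^ x` is `(θ - 1) * θ ^ x * (Λ - s * θ⁻¹)` with `s = min x d`. The threshold `(1
+ γ * θ) / 2 * d` for `s` lies midway between `γ * θ * d`, where the upper bound `γ * d - s * θ⁻¹`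
of the bracket vanishes, and `d`. Above it the bracket is at most `-d * (θ⁻¹ - γ) / 2`; below it `x
= s`, so `θ ^ x` itself is bounded. -/
lemma exponential_drift {γ θ Λ : ℝ} (hθ : 1 < θ) (hγθ : γ * θ < 1) (hγ : 0 < γ)
    {d : ℕ} (hΛ : Λ ≤ γ * d) (x : ℕ) :
    Λ * θ ^ (x + 1) + (min x d : ℕ) * θ ^ (x - 1) + (θ - 1) * d * (θ⁻¹ - γ) / 2 * θ ^ x ≤
      Λ * θ ^ x + (min x d : ℕ) * θ ^ x + (θ - 1) * d * θ ^ ((1 + γ * θ) / 2 * d) := by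
  have hθ0 : 0 < θ := by linarith
  have hη1 : θ⁻¹ < 1 := inv_lt_one_of_one_lt₀ hθ
  have hγη : γ < θ⁻¹ := by rwa [← one_div, lt_div_iff₀ hθ0]
  have hηθ : θ⁻¹ * θ = 1 := inv_mul_cancel₀ hθ0.ne'
  have hd : (0 : ℝ) ≤ d := Nat.cast_nonneg d
  have hs : ((min x d : ℕ) : ℝ) * θ ^ (x - 1) = (min x d : ℕ) * θ⁻¹ * θ ^ x := by
    rcases x with _ | x
    · simp
    · rw [pow_succ, Nat.add_sub_cancel]; field_simp
  rw [hs]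
  generalize hsdef : ((min x d : ℕ) : ℝ) = s
  have hs0 : 0 ≤ s := hsdef ▸ Nat.cast_nonneg _
  have key : θ ^ x * (Λ - s * θ⁻¹ + d * (θ⁻¹ - γ) / 2) ≤ d * θ ^ ((1 + γ * θ) / 2 * d) := by
    by_cases h : (1 + γ * θ) / 2 * d ≤ s
    · have h1 : (1 + γ * θ) / 2 * d * θ⁻¹ ≤ s * θ⁻¹ :=
        mul_le_mul_of_nonneg_right h (inv_pos.2 hθ0).le
      have h2 : (1 + γ * θ) / 2 * d * θ⁻¹ = (θ⁻¹ + γ) / 2 * d := by field_simp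
      have h3 : Λ - s * θ⁻¹ + d * (θ⁻¹ - γ) / 2 ≤ 0 := by linarith
      calc _ ≤ 0 := mul_nonpos_of_nonneg_of_nonpos (by positivity) h3
        _ ≤ _ := by positivity
    · push Not at h
      have hlt : s < d ∨ (d : ℝ) = 0 := by
        rcases hd.eq_or_lt with h0 | h0
        · right; exact h0.symm
        · left; nlinarith
      have hsx : s = x := by
        rcases hlt with h' | h'
        · rw [← hsdef] at h' ⊢
          have : min x d < d := by exact_mod_cast h'
          congr 1; omega
        · rw [h', mul_zero] at h; linarith
      have hpow : θ ^ x ≤ θ ^ ((1 + γ * θ) / 2 * d) := by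
        rw [← Real.rpow_natCast]
        exact Real.rpow_le_rpow_of_exponent_le hθ.le (hsx ▸ h.le)
      have hbr : Λ - s * θ⁻¹ + d * (θ⁻¹ - γ) / 2 ≤ d := by
        have : 0 ≤ s * θ⁻¹ := by positivity
        nlinarith
      calc _ ≤ θ ^ x * d := by gcongr
        _ ≤ θ ^ ((1 + γ * θ) / 2 * d) * d := by gcongr
        _ = _ := mul_comm _ _
  have h1 : 0 < θ - 1 := by linarith
  have h2 := mul_le_mul_of_nonneg_left key h1.le
  have h3 : s * θ⁻¹ * θ ^ x * θ = s * θ ^ x := by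
    calc _ = s * θ ^ x * (θ⁻¹ * θ) := by ring
      _ = _ := by rw [hηθ, mul_one]
  rw [pow_succ]
  nlinarith

lemma isLyapunov_exponential {γ θ : ℝ} (hθ : 1 < θ) (hγθ : γ * θ < 1) (hγ : 0 < γ)
    {Λ : ℝ} (hΛ0 : 0 ≤ Λ) {d : ℕ} (hd : 0 < d) (hΛ : Λ ≤ γ * d) :
    IsLyapunov (ENNReal.ofReal Λ) d (ENNReal.ofReal θ)
      (ENNReal.ofReal ((θ - 1) * d * (θ⁻¹ - γ) / 2))
      (ENNReal.ofReal (2 / (θ⁻¹ - γ) * θ ^ ((1 + γ * θ) / 2 * d))) := by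
  have hθ0 : 0 < θ := by linarith
  have hη1 : θ⁻¹ < 1 := inv_lt_one_of_one_lt₀ hθ
  have hγη : 0 < θ⁻¹ - γ := by rw [sub_pos, ← one_div, lt_div_iff₀ hθ0]; exact hγθ
  have h1 : 0 < θ - 1 := by linarith
  have hd' : (0 : ℝ) < d := by exact_mod_cast hd
  refine ⟨?_, ENNReal.ofReal_ne_top, ?_, ENNReal.ofReal_ne_top, ?_, fun x => ?_⟩
  · rw [ENNReal.one_le_ofReal]; exact hθ.le
  · rw [ne_eq, ENNReal.ofReal_eq_zero, not_le]; positivity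
  · rw [ENNReal.one_le_ofReal]
    -- `κ` is the additive constant of `exponential_drift` divided by `a`; it is at least `1`
    -- because `θ⁻¹ - γ < 1`.
    have h2 : 1 ≤ 2 / (θ⁻¹ - γ) := by rw [le_div_iff₀ hγη]; linarith
    have h3 : 1 ≤ θ ^ ((1 + γ * θ) / 2 * d) := Real.one_le_rpow hθ.le (by positivity)
    nlinarith
  · rw [← ENNReal.ofReal_pow hθ0.le, ← ENNReal.ofReal_pow hθ0.le, ← ENNReal.ofReal_pow hθ0.le,
      ← ENNReal.ofReal_natCast, ← ENNReal.ofReal_mul hΛ0, ← ENNReal.ofReal_mul (by positivity),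
      ← ENNReal.ofReal_mul (by positivity), ← ENNReal.ofReal_mul hΛ0,
      ← ENNReal.ofReal_mul (by positivity), ← ENNReal.ofReal_mul (by positivity),
      ← ENNReal.ofReal_add (by positivity) (by positivity),
      ← ENNReal.ofReal_add (by positivity) (by positivity),
      ← ENNReal.ofReal_add (by positivity) (by positivity),
      ← ENNReal.ofReal_add (by positivity) (by positivity)]
    refine ENNReal.ofReal_le_ofReal ((exponential_drift hθ hγθ hγ hΛ x).trans (le_of_eq ?_))
    congr 1
    have hne := hγη.ne'
    generalize θ⁻¹ - γ = η at hne ⊢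
    field_simp

/-- Bernoulli's inequality for the excess `y = x - d`; the factor `(θ ^ d)⁻¹` is the source of the
exponential decay. -/
lemma natCast_sub_le_mul_pow {θ : ℝ} (hθ : 1 < θ) (d x : ℕ) :
    ((x + 1 - d : ℕ) : ℝ≥0∞) ≤ ENNReal.ofReal (θ / (θ - 1) * (θ ^ d)⁻¹) * ENNReal.ofReal θ ^ x := by
  have hθ0 : 0 < θ := by linarith
  have h1 : 0 < θ - 1 := by linarith
  rw [← ENNReal.ofReal_pow hθ0.le, ← ENNReal.ofReal_mul (by positivity), ← ENNReal.ofReal_natCast]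
  refine ENNReal.ofReal_le_ofReal ?_
  by_cases h : d ≤ x
  · obtain ⟨y, rfl⟩ := Nat.exists_eq_add_of_le h
    rw [show d + y + 1 - d = y + 1 by omega, pow_add]
    have h2 : 1 + (y : ℝ) * (θ - 1) ≤ θ ^ y := by
      have := one_add_mul_le_pow (a := θ - 1) (by linarith) y
      simpa using this
    calc ((y + 1 : ℕ) : ℝ) ≤ θ / (θ - 1) * (1 + y * (θ - 1)) := by
          rw [div_mul_eq_mul_div, le_div_iff₀ h1]
          push_cast
          have : (0 : ℝ) ≤ y := Nat.cast_nonneg y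
          nlinarith [mul_nonneg this (sq_nonneg (θ - 1))]
      _ ≤ θ / (θ - 1) * θ ^ y := by gcongr
      _ = _ := by field_simp
  · rw [show x + 1 - d = 0 by omega]
    simp only [Nat.cast_zero]
    positivity

/-- The expected waiting time of every job is exponentially small in the size of the cluster. -/
lemma lintegral_waitingTime_le_exp {γ θ : ℝ} (hθ : 1 < θ) (hγθ : γ * θ < 1) (hγ0 : 0 < γ)
    (hγ1 : γ < 1) {n : ℕ} [NeZero n] {d : ℕ} {g : Architecture n} (hg : IsModular d g)
    (π : GreedyPolicy n) {rate : Fin n → ℝ} (hrate : rate ∈ γ • capacityRegion g) {i : Fin n}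
    (hi : 0 < rate i) (m : ℕ) :
    ∫⁻ ω, waitingTime g π rate ω i m ∂(law n) ≤
      ENNReal.ofReal (θ / (θ - 1) * (2 / (θ⁻¹ - γ)) / (1 - γ) *
        Real.exp (-((1 - γ * θ) / 2 * Real.log θ * d))) := by
  obtain ⟨hd, hcl⟩ := hg.exists_isCluster
  obtain ⟨A, B, hC, hiA⟩ := hcl i
  have hθ0 : 0 < θ := by linarith
  have h1 : 0 < θ - 1 := by linarith
  have hγη : 0 < θ⁻¹ - γ := by rw [sub_pos, ← one_div, lt_div_iff₀ hθ0]; exact hγθ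
  have h2 : 0 < 1 - γ := by linarith
  have hnn := nonneg_of_mem_smul_capacityRegion hγ0.le hrate
  have hΛ := hC.sum_rate_le hγ0.le hrate
  have hΛ0 : 0 ≤ ∑ i ∈ A, rate i := Finset.sum_nonneg fun i _ => hnn i
  have hsum : ∑ i ∈ A, ENNReal.ofReal (rate i) = ENNReal.ofReal (∑ i ∈ A, rate i) :=
    (ENNReal.ofReal_sum_of_nonneg fun i _ => hnn i).symm
  have hL := isLyapunov_exponential hθ hγθ hγ0 hΛ0 hd hΛ
  rw [← hsum] at hL
  -- The spare capacity `(1 - γ) * d` is at least `1 - γ`, as `d ≥ 1`; this cruder value keeps the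
  -- constant free of `d`.
  refine (lintegral_waitingTime_le hC hL (δ := ENNReal.ofReal (1 - γ)) ?_ ?_
    (natCast_sub_le_mul_pow hθ d) (ENNReal.mul_ne_top ENNReal.ofReal_ne_top ENNReal.ofReal_ne_top)
    hiA hi m).trans (le_of_eq ?_)
  · rw [hsum, ← ENNReal.ofReal_add hΛ0 h2.le, ← ENNReal.ofReal_natCast]
    refine ENNReal.ofReal_le_ofReal ?_
    have : (1 : ℝ) ≤ d := by exact_mod_cast hd
    nlinarith
  · simpa using hγ1
  · rw [← ENNReal.ofReal_mul (by positivity), ← ENNReal.ofReal_div_of_pos h2]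
    congr 1
    -- The exponents `-d` from `C` and `(1 + γ * θ) / 2 * d` from `κ` add up to `-(1 - γ * θ) / 2 *
    -- d`.
    have hexp : Real.exp (-((1 - γ * θ) / 2 * Real.log θ * d)) =
        (θ ^ d)⁻¹ * θ ^ ((1 + γ * θ) / 2 * d) := by
      rw [← Real.rpow_natCast θ d, ← Real.rpow_neg hθ0.le, ← Real.rpow_add hθ0,
        Real.rpow_def_of_pos hθ0]
      congr 1
      ring
    rw [hexp]
    ring

end Flex

end

/-! ### The theorem -/

theorem theorem4 (γ : ℝ) (hγ0 : 0 < γ) (hγ1 : γ < 1) :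
    ∃ c : ℝ, 0 < c ∧ ∃ K : ℝ, 0 < K ∧
      ∀ (n : ℕ) [NeZero n] (d : ℕ) (g : Flex.Architecture n), Flex.IsModular d g →
        ∀ (π : Flex.GreedyPolicy n) (rate : Fin n → ℝ), rate ∈ γ • Flex.capacityRegion g →
          Flex.expectedDelay g π rate ≤ ENNReal.ofReal (K * Real.exp (-(c * d))) := by
  -- `θ > 1` makes the moment exponential, and `γ * θ < 1` leaves room for negative drift below full
  -- occupancy. As `θ` depends on `γ` alone, so do `c` and `K`.
  obtain ⟨θ, hθ, hθγ⟩ := exists_between (one_lt_inv_iff₀.2 ⟨hγ0, hγ1⟩)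
  have hγθ : γ * θ < 1 := by
    calc γ * θ < γ * γ⁻¹ := by gcongr
      _ = 1 := mul_inv_cancel₀ hγ0.ne'
  have hθ0 : 0 < θ := by linarith
  have h1 : 0 < θ - 1 := by linarith
  have hγη : 0 < θ⁻¹ - γ := by rw [sub_pos, ← one_div, lt_div_iff₀ hθ0]; exact hγθ
  have h2 : 0 < 1 - γ := by linarith
  have h3 : 0 < 1 - γ * θ := by linarith
  refine ⟨(1 - γ * θ) / 2 * Real.log θ, mul_pos (by positivity) (Real.log_pos hθ),
    θ / (θ - 1) * (2 / (θ⁻¹ - γ)) / (1 - γ), by positivity, ?_⟩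
  intro n _ d g hg π rate hrate
  unfold Flex.expectedDelay
  -- The average is bounded term by term with weights `rate i`; queues of rate `0` contribute
  -- nothing, and the bound for the others holds for every job, not only in the limit.
  refine ENNReal.div_le_of_le_mul ?_
  rw [Finset.mul_sum]
  refine Finset.sum_le_sum fun i _ => ?_
  rw [mul_comm]
  by_cases hi : 0 < rate i
  · gcongr
    exact Filter.limsup_le_of_le (by isBoundedDefault) (Filter.Eventually.of_forall fun m =>
      Flex.lintegral_waitingTime_le_exp hθ hγθ hγ0 hγ1 hg π hrate hi m)
  · simp [ENNReal.ofReal_eq_zero.2 (not_lt.1 hi)]
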